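/- **Setting.** A smoothing scheme on a measurable space $\mathcal X$ assigns to each $x$ the law of a random point $\xi(x)$. A threat model is a map $\mathcal B:\mathcal X\to 2^{\mathcal X}$; its inverted ball is the smallest map $\mathcal B^{-1}$ with $\tilde x\in\mathcal B(x)\Rightarrow x\in\mathcal B^{-1}(\tilde x)$, i.e. $\mathcal B^{-1}(\tilde x)=\{x:\tilde x\in\mathcal B(x)\}$. For $p\in[0,1]$ the optimal certified bounds at $x$ are $$\mathrm c^{\downarrow}[p,\mathcal B]=\inf\ \mathbb E[h(\xi(\tilde x))],\qquad \mathrm c^{\uparrow}[p,\mathcal B]=\sup\ \mathbb E[h(\xi(\tilde x))],$$ over all $\tilde x\in\mathcal B(x)$ and all measurable $h:\mathcal X\to[0,1]$ with $\mathbb E[h(\xi(x))]=p$. **Inverted balls.** For the closed $\ell_1$ and $\ell_2$ balls $\mathcal B_r$ in $\mathbb R^d$, $\mathcal B_r^{-1}=\mathcal B_r$. For $x\in\{0,1\}^d$ let $\mathcal B_{r_a,r_d}(x)$ be the set of vectors obtained from $x$ by toggling at most $r_a$ zero bits and at most $r_d$ one bits; then $\mathcal B_{r_a,r_d}^{-1}=\mathcal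 B_{r_d,r_a}$. **Gaussian smoothing.** Let $\xi(x)=x+\varepsilon$ with $\varepsilon\sim\mathcal N(0,\sigma^2 I)$ on $\mathbb R^d$, $\sigma>0$, $r\ge0$, let $\mathcal B_r$ be the $\ell_1$ or the $\ell_2$ ball, and let $\Phi_\sigma$ be the distribution function of $\mathcal N(0,\sigma^2)$ on $\mathbb R$. If $d\ge1$ and $p\in(0,1)$, then at every point both optima are attained, with $\mathrm c^{\downarrow}[p,\mathcal B_r]=\Phi_\sigma(\Phi_\sigma^{-1}(p)-r)$ and $\mathrm c^{\uparrow}[p,\mathcal B_r]=\Phi_\sigma(\Phi_\sigma^{-1}(p)+r)$. For every $d$, every $p\in[0,1]$ and any two points at which the lower and the upper bound are taken, $\mathrm c^{\downarrow}[\mathrm c^{\uparrow}[p,\mathcal B_r^{-1}],\mathcal B_r]=p$. **Uniform smoothing.** Let $\lambda>0$, $r\ge0$, and consider the Lipschitz bounds $\ell^{\downarrow}(p)=p-\frac r{2\lambda}$ and $\ell^{\uparrow}(p)=p+\frac r{2\lambda}$ on $\mathbb R$. (a) $\ell^{\downarrow}(\ell^{\uparrow}(p))=p$ for all $p\in\mathbb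 R$. (b) For $\xi(x)=x+\varepsilon$, $\varepsilon$ uniform on $[0,2\lambda]^d$, and the $\ell_1$ ball $\mathcal B_r$: if $d\ge1$ and $p\in[0,1]$, both optima are attained at every point, with $\mathrm c^{\downarrow}[p,\mathcal B_r]=\max(0,\ell^{\downarrow}(p))$ and $\mathrm c^{\uparrow}[p,\mathcal B_r]=\min(1,\ell^{\uparrow}(p))$. For every $d$ and any two points, $\mathrm c^{\downarrow}[\mathrm c^{\uparrow}[p,\mathcal B_r^{-1}],\mathcal B_r]=p$ for all $p\in[0,1]$ with $\ell^{\uparrow}(p)\le1$. For the $\ell_2$ ball the same identity holds for all $p\in[0,1]$ with $\mathrm c^{\uparrow}[p,\mathcal B_r^{-1}]<1$. (c) Let $s$ be a random vector in $\mathbb R^d$ with arbitrary joint law and each $s_i$ uniform on $[0,2\lambda]$, and let $\xi(x)$ be smoothing with splitting noise, $$\xi(x)_i=\tfrac12\Big(\min\big(2\lambda\big\lceil\tfrac{x_i-s_i}{2\lambda}\big\rceil+s_i,\,1\big)+\max\big(2\lambda\big\lceil\tfrac{x_i-s_i}{2\lambda}-1\big\rceil+s_i,\,0\big)\Big).$$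 Then $\ell^{\downarrow}$ and $\ell^{\uparrow}$ are certified bounds for the $\ell_1$ ball: $\ell^{\downarrow}(p)\le\mathbb E[h(\xi(\tilde x))]\le\ell^{\uparrow}(p)$ whenever $\|\tilde x-x\|_1\le r$, $h:\mathbb R^d\to[0,1]$ is measurable and $\mathbb E[h(\xi(x))]=p$. **Sparse smoothing.** Let $p_0,p_1\in(0,1)$ and let $\xi(x)=x\oplus\varepsilon$ on $\{0,1\}^d$ with independent $\varepsilon_i\sim\mathrm{Bernoulli}(p_{x_i})$. Let $u=(0,\dots,0,1,\dots,1)\in\{0,1\}^{r_a+r_d}$ with $r_a$ zeros and $r_d$ ones, $\tilde u=\mathbf 1-u$, and, for $0\le q\le r_a+r_d$, $t_q=\Pr[\|\xi(u)-u\|_0=q]$, $\tilde t_q=\Pr[\|\xi(\tilde u)-u\|_0=q]$. Let $L_{r_a,r_d}(p)$ and $U_{r_a,r_d}(p)$ be the minimum and the maximum of $\sum_q h_q\tilde t_q$ over $h\in[0,1]^{r_a+r_d+1}$ with $\sum_q h_qt_q=p$. (a) $L_{r_a,r_d}(U_{r_d,r_a}(p))=p$ for all $p\in[0,1]$. (b)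 For every $d$, every $x\in\{0,1\}^d$, every $\tilde x\in\mathcal B_{r_a,r_d}(x)$ and every $h:\{0,1\}^d\to[0,1]$ with $\mathbb E[h(\xi(x))]=p$, $L_{r_a,r_d}(p)\le\mathbb E[h(\xi(\tilde x))]\le U_{r_a,r_d}(p)$. (c) If $x$ has at least $r_a$ zero bits and at least $r_d$ one bits, then for all $p\in[0,1]$ both optima at $x$ are attained and $\mathrm c^{\downarrow}[p,\mathcal B_{r_a,r_d}]=L_{r_a,r_d}(p)$, $\mathrm c^{\uparrow}[p,\mathcal B_{r_a,r_d}]=U_{r_a,r_d}(p)$. (d) $\mathrm c^{\downarrow}[\mathrm c^{\uparrow}[p,\mathcal B_{r_a,r_d}^{-1}],\mathcal B_{r_a,r_d}]=p$ for all $p\in[0,1]$, where the lower bound is taken at any $x\in\{0,1\}^d$ with at least $r_a$ zero and $r_d$ one bits and the upper bound at any $y\in\{0,1\}^d$ with at least $r_d$ zero and $r_a$ one bits. -/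

import Mathlib

open MeasureTheory ProbabilityTheory
open scoped ENNReal NNReal

noncomputable section

namespace Smoothing

/-! ### Balls and inverted balls -/

/-- The inverted ball of a threat model `B`: the smallest set-valued map `B'` such that
`x̃ ∈ B x` always implies `x ∈ B' x̃` (see `invBall_isLeast`). -/
def invBall {X : Type*} (B : X → Set X) : X → Set X :=
  fun x' => {x | x' ∈ B x}

theorem invBall_isLeast {X : Type*} (B : X → Set X) :
    IsLeast {B' : X → Set X | ∀ x, ∀ x' ∈ B x, x ∈ B' x'} (invBall B) :=
  ⟨fun _ _ h => h, fun _ hB' x' x hx => hB' x x' hx⟩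

/-- The closed `ℓ_q` ball of radius `r` in `ℝ^d`. -/
def lpBall {d : ℕ} (q : ℝ≥0∞) (r : ℝ) (x : Fin d → ℝ) : Set (Fin d → ℝ) :=
  {x' | ‖WithLp.toLp q (x' - x)‖ ≤ r}

/-- Binary vectors obtained from `x` by toggling at most `ra` zero bits and `rd` one bits. -/
def sparseBall {d : ℕ} (ra rd : ℕ) (x : Fin d → Bool) : Set (Fin d → Bool) :=
  {x' | (Finset.univ.filter fun i => x i = true ∧ x' i = false).card ≤ rd ∧
    (Finset.univ.filter fun i => x i = false ∧ x' i = true).card ≤ ra}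

/-! ### Certified bounds of a smoothing scheme

A smoothing scheme on `X` is given by the law `ξ x` of the randomized point, for every `x`. -/

/-- The values `E[h(ξ(x̃))]` that are possible for `x̃ ∈ B x` and a measurable
`h : X → [0,1]` with `E[h(ξ(x))] = p`. -/
def certValues {X : Type*} [MeasurableSpace X] (ξ : X → Measure X) (B : X → Set X)
    (x : X) (p : ℝ) : Set ℝ :=
  {v | ∃ x' ∈ B x, ∃ h : X → ℝ, Measurable h ∧ (∀ z, h z ∈ Set.Icc (0 : ℝ) 1) ∧
    ∫ z, h z ∂(ξ x) = p ∧ ∫ z, h z ∂(ξ x') = v}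

/-- Certified lower bound: the optimal value of the minimization problem. -/
def certLower {X : Type*} [MeasurableSpace X] (ξ : X → Measure X) (B : X → Set X)
    (x : X) (p : ℝ) : ℝ :=
  sInf (certValues ξ B x p)

/-- Certified upper bound: the optimal value of the maximization problem. -/
def certUpper {X : Type*} [MeasurableSpace X] (ξ : X → Measure X) (B : X → Set X)
    (x : X) (p : ℝ) : ℝ :=
  sSup (certValues ξ B x p)

/-! ### Gaussian smoothing -/

/-- The law of `x + ε`, where `ε` has independent `N(0, σ²)` coordinates. -/
def gaussianScheme {d : ℕ} (σ : ℝ≥0) (x : Fin d → ℝ) : Measure (Fin d → ℝ) :=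
  (Measure.pi fun _ : Fin d => gaussianReal 0 (σ ^ 2)).map fun ε => x + ε

/-- Distribution function of `N(0, σ²)` on `ℝ`. -/
def gaussCDF (σ : ℝ≥0) (t : ℝ) : ℝ := cdf (gaussianReal 0 (σ ^ 2)) t

/-- Quantile function of `N(0, σ²)`; the inverse of `gaussCDF σ` on `(0, 1)` if `0 < σ`. -/
def gaussQuantile (σ : ℝ≥0) (p : ℝ) : ℝ := sInf {t : ℝ | p ≤ gaussCDF σ t}

/-! ### Uniform smoothing -/

/-- The law of `x + ε`, where `ε` is uniform on `[0, 2λ]^d` (with `l` for `λ`). -/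
def uniformScheme {d : ℕ} (l : ℝ) (x : Fin d → ℝ) : Measure (Fin d → ℝ) :=
  (Measure.pi fun _ : Fin d => cond (volume : Measure ℝ) (Set.Icc 0 (2 * l))).map
    fun ε => x + ε

/-- Lower bound that subtracts `r` times the Lipschitz constant `1/(2λ)`. -/
def lipLower (l r p : ℝ) : ℝ := p - r / (2 * l)

/-- Upper bound that adds `r` times the Lipschitz constant `1/(2λ)`. -/
def lipUpper (l r p : ℝ) : ℝ := p + r / (2 * l)

/-- Splitting noise: each coordinate `x i` is replaced by the midpoint of the cell that
contains it when `[0, 1]` is cut at the points of `s i + 2λℤ`. -/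
def splitPoint {d : ℕ} (l : ℝ) (x s : Fin d → ℝ) : Fin d → ℝ := fun i =>
  (min (2 * l * (⌈(x i - s i) / (2 * l)⌉ : ℝ) + s i) 1 +
    max (2 * l * (⌈(x i - s i) / (2 * l) - 1⌉ : ℝ) + s i) 0) / 2

/-- Smoothing with splitting noise, for offsets `s` with joint law `ν`. -/
def splitScheme {d : ℕ} (l : ℝ) (ν : Measure (Fin d → ℝ)) (x : Fin d → ℝ) :
    Measure (Fin d → ℝ) :=
  ν.map fun s => splitPoint l x s

/-! ### Sparse smoothing -/

/-- The law of `x ⊕ ε` with independent `ε i ∼ Bernoulli(p0)` where `x i = 0` and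
`ε i ∼ Bernoulli(p1)` where `x i = 1`. -/
def sparseScheme {d : ℕ} (p0 p1 : unitInterval) (x : Fin d → Bool) :
    Measure (Fin d → Bool) :=
  (Measure.pi fun i : Fin d => bernoulliMeasure true false (if x i then p1 else p0)).map
    fun ε i => xor (x i) (ε i)

/-- `x` has at least `a` zero bits and at least `b` one bits. -/
def HasBits {d : ℕ} (a b : ℕ) (x : Fin d → Bool) : Prop :=
  a ≤ (Finset.univ.filter fun i => x i = false).card ∧
    b ≤ (Finset.univ.filter fun i => x i = true).card

/-- The canonical point `[0, …, 0, 1, …, 1]` with `ra` zeros and `rd` ones. -/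
def canonPoint (ra rd : ℕ) : Fin (ra + rd) → Bool :=
  Fin.append (fun _ => false) (fun _ => true)

/-- The canonical perturbed point `1 - canonPoint`. -/
def canonPoint' (ra rd : ℕ) : Fin (ra + rd) → Bool := fun i => !canonPoint ra rd i

/-- Probability that the randomized `canonPoint` is at Hamming distance `q` from
`canonPoint`. -/
def regionMass (p0 p1 : unitInterval) (ra rd : ℕ) (q : Fin (ra + rd + 1)) : ℝ :=
  (sparseScheme p0 p1 (canonPoint ra rd)).real
    {z | hammingDist (canonPoint ra rd) z = (q : ℕ)}

/-- Probability that the randomized `canonPoint'` is at Hamming distance `q` from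
`canonPoint`. -/
def regionMass' (p0 p1 : unitInterval) (ra rd : ℕ) (q : Fin (ra + rd + 1)) : ℝ :=
  (sparseScheme p0 p1 (canonPoint' ra rd)).real
    {z | hammingDist (canonPoint ra rd) z = (q : ℕ)}

/-- Feasible values of the linear program with one variable in `[0, 1]` for each of the
`ra + rd + 1` regions of constant likelihood ratio. -/
def lpValues (p0 p1 : unitInterval) (ra rd : ℕ) (p : ℝ) : Set ℝ :=
  {v | ∃ h : Fin (ra + rd + 1) → ℝ, (∀ q, h q ∈ Set.Icc (0 : ℝ) 1) ∧
    ∑ q, h q * regionMass p0 p1 ra rd q = p ∧ ∑ q, h q * regionMass' p0 p1 ra rd q = v}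

/-- Certified lower bound of sparse smoothing for `sparseBall ra rd`. -/
def sparseLower (p0 p1 : unitInterval) (ra rd : ℕ) (p : ℝ) : ℝ :=
  sInf (lpValues p0 p1 ra rd p)

/-- Certified upper bound of sparse smoothing for `sparseBall ra rd`. -/
def sparseUpper (p0 p1 : unitInterval) (ra rd : ℕ) (p : ℝ) : ℝ :=
  sSup (lpValues p0 p1 ra rd p)

end Smoothing

end

/-!
The pairs `(E_μ h, E_ν h)` of all tests `h` form a convex region that contains the diagonal, and the
certified bounds at `p` are the ends of the section above `p` of such regions. Interchanging `μ` and
`ν` reflects the region in the diagonal. When inverting the ball reflects the regions as well, a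
convexity argument on the segments to `(1, 1)` shows that the lower bound inverts the upper bound.

For Gaussian noise, the displacement is the only direction that matters, and the Neyman–Pearson
lemma applies to the remaining normal laws on `ℝ`. Two uniform laws agree where both have mass, so
their distance in total variation determines the region; the same kind of common mass bounds
splitting noise, through the grids that do not separate two points. For binary vectors, the bits
that are not toggled can be simulated, and the Hamming distance is a sufficient statistic for the
others.
-/

namespace Smoothing

theorem mk_max_mem_of_convex {R : Set (ℝ × ℝ)} (hR : Convex ℝ R) {τ p : ℝ} (h0 : (0, 0) ∈ R)
    (hτ : (τ, 0) ∈ R) (h1 : (1, 1 - τ) ∈ R) (hp : p ∈ Set.Icc (0 : ℝ) 1) :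
    (p, max 0 (p - τ)) ∈ R := by
  obtain hpτ | hτp := le_total p τ
  · rw [max_eq_left (sub_nonpos.2 hpτ)]
    exact (hR.linear_preimage (LinearMap.inl ℝ ℝ ℝ)).ordConnected.out h0 hτ ⟨hp.1, hpτ⟩
  · rw [max_eq_right (sub_nonneg.2 hτp)]
    have hline := (hR.affine_preimage
      ((AffineMap.id ℝ ℝ).prod (AffineMap.id ℝ ℝ - AffineMap.const ℝ ℝ τ))).ordConnected
    exact hline.out (x := τ) (by simpa using hτ) (by simpa using h1) ⟨hτp, hp.2⟩

section TestRegion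

variable {X Y : Type*} [MeasurableSpace X] [MeasurableSpace Y] {μ ν : Measure X}

/-- The pairs `(E_μ h, E_ν h)` of all randomized tests `h : X → [0, 1]`, that is, the region of
achievable size and power when `μ` is tested against `ν`. Both certified bounds are optimal values
over vertical sections of such regions (see `mem_certValues`). -/
def testRegion (μ ν : Measure X) : Set (ℝ × ℝ) :=
  {z | ∃ h : X → ℝ, Measurable h ∧ (∀ x, h x ∈ Set.Icc (0 : ℝ) 1) ∧
    ∫ x, h x ∂μ = z.1 ∧ ∫ x, h x ∂ν = z.2}

theorem mem_certValues {ξ : X → Measure X} {B : X → Set X} {x : X} {p v : ℝ} :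
    v ∈ certValues ξ B x p ↔ ∃ x' ∈ B x, (p, v) ∈ testRegion (ξ x) (ξ x') :=
  Iff.rfl

theorem integrable_of_mem_unitInterval [IsFiniteMeasure μ] {h : X → ℝ} (hm : Measurable h)
    (h01 : ∀ x, h x ∈ Set.Icc (0 : ℝ) 1) : Integrable h μ :=
  .of_mem_Icc 0 1 hm.aemeasurable (.of_forall h01)

theorem testRegion_subset_Icc_prod_Icc [IsProbabilityMeasure μ] [IsProbabilityMeasure ν] :
    testRegion μ ν ⊆ Set.Icc 0 1 ×ˢ Set.Icc 0 1 := by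
  have key (ρ : Measure X) [IsProbabilityMeasure ρ] {h : X → ℝ} (hm : Measurable h)
      (h01 : ∀ x, h x ∈ Set.Icc (0 : ℝ) 1) : ∫ x, h x ∂ρ ∈ Set.Icc (0 : ℝ) 1 :=
    ⟨integral_nonneg fun x => (h01 x).1, by
      simpa using integral_mono (μ := ρ) (integrable_of_mem_unitInterval hm h01)
        (integrable_const 1) fun x => (h01 x).2⟩
  rintro ⟨a, b⟩ ⟨h, hm, h01, rfl, rfl⟩
  exact ⟨key μ hm h01, key ν hm h01⟩

theorem mk_self_mem_testRegion [IsProbabilityMeasure μ] [IsProbabilityMeasure ν] {p : ℝ}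
    (hp : p ∈ Set.Icc (0 : ℝ) 1) : (p, p) ∈ testRegion μ ν :=
  ⟨fun _ => p, measurable_const, fun _ => hp, by simp, by simp⟩

theorem measureReal_mem_testRegion {A : Set X} (hA : MeasurableSet A) :
    (μ.real A, ν.real A) ∈ testRegion μ ν :=
  ⟨A.indicator 1, measurable_one.indicator hA,
    fun x => ⟨Set.indicator_nonneg (fun _ _ => zero_le_one) x,
      Set.indicator_le_self' (fun _ _ => zero_le_one) x⟩,
    integral_indicator_one hA, integral_indicator_one hA⟩

theorem testRegion_swap {a b : ℝ} : (b, a) ∈ testRegion ν μ ↔ (a, b) ∈ testRegion μ ν := by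
  simp only [testRegion, Set.mem_ofPred_eq, and_comm]

theorem one_sub_mem_testRegion [IsProbabilityMeasure μ] [IsProbabilityMeasure ν] {a b : ℝ} :
    (1 - a, 1 - b) ∈ testRegion μ ν ↔ (a, b) ∈ testRegion μ ν := by
  have key {a b : ℝ} (hz : (a, b) ∈ testRegion μ ν) : (1 - a, 1 - b) ∈ testRegion μ ν := by
    obtain ⟨h, hm, h01, rfl, rfl⟩ := hz
    refine ⟨fun x => 1 - h x, measurable_const.sub hm,
      fun x => ⟨sub_nonneg.2 (h01 x).2, sub_le_self 1 (h01 x).1⟩, ?_, ?_⟩ <;>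
    · rw [integral_sub (integrable_const 1) (integrable_of_mem_unitInterval hm h01)]
      simp
  exact ⟨fun h => by simpa only [sub_sub_cancel] using key h, key⟩

theorem convex_testRegion [IsFiniteMeasure μ] [IsFiniteMeasure ν] :
    Convex ℝ (testRegion μ ν) := by
  rintro _ ⟨g, gm, g01, hg⟩ _ ⟨h, hm, h01, hh⟩ a b ha hb hab
  refine ⟨fun x => a * g x + b * h x, (gm.const_mul a).add (hm.const_mul b),
    fun x => convex_Icc 0 1 (g01 x) (h01 x) ha hb hab, ?_⟩
  have key (ρ : Measure X) [IsFiniteMeasure ρ] :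
      ∫ x, a * g x + b * h x ∂ρ = a * ∫ x, g x ∂ρ + b * ∫ x, h x ∂ρ := by
    rw [integral_add ((integrable_of_mem_unitInterval gm g01).const_mul a)
      ((integrable_of_mem_unitInterval hm h01).const_mul b), integral_const_mul,
      integral_const_mul]
  simp [key, hg, hh]

theorem testRegion_map_subset {f : X → Y} (hf : Measurable f) :
    testRegion (μ.map f) (ν.map f) ⊆ testRegion μ ν := by
  rintro _ ⟨h, hm, h01, h1, h2⟩
  rw [integral_map hf.aemeasurable hm.aestronglyMeasurable] at h1 h2
  exact ⟨h ∘ f, hm.comp hf, fun x => h01 (f x), h1, h2⟩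

theorem testRegion_map_equiv (e : X ≃ᵐ Y) :
    testRegion (μ.map e) (ν.map e) = testRegion μ ν := by
  refine (testRegion_map_subset e.measurable).antisymm ?_
  simpa only [e.map_symm_map] using
    testRegion_map_subset (μ := μ.map e) (ν := ν.map e) e.symm.measurable

/-- Averaging a randomized test over an independent second observation gives a test of the first
observation with the same size and power. -/
theorem testRegion_prod_subset [IsFiniteMeasure μ] [IsFiniteMeasure ν] (π : Measure Y)
    [IsProbabilityMeasure π] : testRegion (μ.prod π) (ν.prod π) ⊆ testRegion μ ν := by
  rintro _ ⟨h, hm, h01, h1, h2⟩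
  refine ⟨fun x => ∫ y, h (x, y) ∂π, hm.stronglyMeasurable.integral_prod_right'.measurable,
    fun x => ?_, ?_, ?_⟩
  · have hx : Measurable fun y => h (x, y) := hm.comp measurable_prodMk_left
    exact (convex_Icc (0 : ℝ) 1).integral_mem isClosed_Icc (.of_forall fun y => h01 (x, y))
      (integrable_of_mem_unitInterval hx fun y => h01 (x, y))
  · rw [← h1, integral_prod _ (integrable_of_mem_unitInterval hm h01)]
  · rw [← h2, integral_prod _ (integrable_of_mem_unitInterval hm h01)]

theorem eq_one_of_one_mem_testRegion [IsProbabilityMeasure μ] [IsProbabilityMeasure ν]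
    (hνμ : ν ≪ μ) {v : ℝ} (hv : (1, v) ∈ testRegion μ ν) : v = 1 := by
  obtain ⟨h, hm, h01, h1, rfl⟩ := hv
  have hint : Integrable (fun x => 1 - h x) μ :=
    (integrable_const 1).sub (integrable_of_mem_unitInterval hm h01)
  have hzero : ∫ x, (1 - h x) ∂μ = 0 := by
    rw [integral_sub (integrable_const 1) (integrable_of_mem_unitInterval hm h01), h1]
    simp
  have hae : (fun x => 1 - h x) =ᵐ[μ] 0 :=
    (integral_eq_zero_iff_of_nonneg (fun x => sub_nonneg.2 (h01 x).2) hint).1 hzero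
  have hone : h =ᵐ[ν] fun _ => 1 := hνμ.ae_le <| hae.mono fun x hx => (sub_eq_zero.1 hx).symm
  simp [integral_congr_ae hone]

theorem eq_zero_of_zero_mem_testRegion [IsProbabilityMeasure μ] [IsProbabilityMeasure ν]
    (hνμ : ν ≪ μ) {v : ℝ} (hv : (0, v) ∈ testRegion μ ν) : v = 0 :=
  sub_eq_self.1 <| eq_one_of_one_mem_testRegion hνμ <|
    by simpa only [sub_zero] using one_sub_mem_testRegion.2 hv

/-- **Neyman–Pearson lemma**, without densities: rejecting on a set `A` below which the likelihood
ratio of `ν` to `μ` is at most `k`, and off which it is at least `k`, minimizes the power. -/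
theorem isLeast_testRegion_of_restrict_le [IsFiniteMeasure μ] [IsFiniteMeasure ν] {A : Set X}
    (hA : MeasurableSet A) {k : ℝ≥0} (hle : ν.restrict A ≤ (k : ℝ≥0∞) • μ.restrict A)
    (hge : (k : ℝ≥0∞) • μ.restrict Aᶜ ≤ ν.restrict Aᶜ) :
    IsLeast {v | (μ.real A, v) ∈ testRegion μ ν} (ν.real A) := by
  refine ⟨measureReal_mem_testRegion hA, ?_⟩
  rintro _ ⟨h, hm, h01, h1, rfl⟩
  have hint (ρ : Measure X) [IsFiniteMeasure ρ] : Integrable h ρ :=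
    integrable_of_mem_unitInterval hm h01
  have hon : ∫ x in A, (1 - h x) ∂ν ≤ k * ∫ x in A, (1 - h x) ∂μ := by
    rw [← smul_eq_mul, ← ENNReal.coe_toReal, ← integral_smul_measure]
    exact integral_mono_measure hle (.of_forall fun x => sub_nonneg.2 (h01 x).2)
      (((integrable_const 1).sub (hint _)).smul_measure ENNReal.coe_ne_top)
  have hoff : k * ∫ x in Aᶜ, h x ∂μ ≤ ∫ x in Aᶜ, h x ∂ν := by
    rw [← smul_eq_mul, ← ENNReal.coe_toReal, ← integral_smul_measure]
    exact integral_mono_measure hge (.of_forall fun x => (h01 x).1) (hint _)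
  have hsplit (ρ : Measure X) [IsFiniteMeasure ρ] :
      ∫ x in A, (1 - h x) ∂ρ - ∫ x in Aᶜ, h x ∂ρ = ρ.real A - ∫ x, h x ∂ρ := by
    rw [integral_sub (integrable_const 1) (hint _), ← integral_add_compl hA (hint ρ)]
    simp
    ring
  nlinarith [hsplit μ, hsplit ν]

theorem isLeast_testRegion_withDensity [IsFiniteMeasure μ] {L : X → ℝ≥0∞}
    [IsFiniteMeasure (μ.withDensity L)] {A : Set X} (hA : MeasurableSet A) {k : ℝ≥0}
    (hle : ∀ x ∈ A, L x ≤ k) (hge : ∀ x ∉ A, k ≤ L x) :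
    IsLeast {v | (μ.real A, v) ∈ testRegion μ (μ.withDensity L)} ((μ.withDensity L).real A) := by
  refine isLeast_testRegion_of_restrict_le hA (k := k) ?_ ?_
  · rw [restrict_withDensity hA, ← withDensity_const]
    exact withDensity_mono ((ae_restrict_iff' hA).2 (.of_forall hle))
  · rw [restrict_withDensity hA.compl, ← withDensity_const]
    exact withDensity_mono ((ae_restrict_iff' hA.compl).2 (.of_forall hge))

theorem fst_le_of_mem_testRegion_of_common_le [IsProbabilityMeasure μ] [IsFiniteMeasure ν]
    {ρ : Measure X} (hμ : ρ ≤ μ) (hν : ρ ≤ ν) {z : ℝ × ℝ} (hz : z ∈ testRegion μ ν) :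
    z.1 ≤ z.2 + (1 - ρ.real Set.univ) := by
  have : IsFiniteMeasure ρ := isFiniteMeasure_of_le μ hμ
  obtain ⟨h, hm, h01, h1, h2⟩ := hz
  have hint (π : Measure X) [IsFiniteMeasure π] : Integrable h π :=
    integrable_of_mem_unitInterval hm h01
  have hcompl : ∫ x, (1 - h x) ∂ρ ≤ ∫ x, (1 - h x) ∂μ :=
    integral_mono_measure hμ (.of_forall fun x => sub_nonneg.2 (h01 x).2)
      ((integrable_const 1).sub (hint μ))
  have hmono : ∫ x, h x ∂ρ ≤ ∫ x, h x ∂ν :=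
    integral_mono_measure hν (.of_forall fun x => (h01 x).1) (hint ν)
  rw [integral_sub (integrable_const 1) (hint ρ), integral_sub (integrable_const 1) (hint μ)]
    at hcompl
  simp only [integral_const, probReal_univ, smul_eq_mul, mul_one] at hcompl
  linarith

theorem exists_comp_ae_eq_condExp [IsFiniteMeasure μ] {T : X → Y} (hT : Measurable T)
    {h : X → ℝ} (hm : Measurable h) (h01 : ∀ x, h x ∈ Set.Icc (0 : ℝ) 1) :
    ∃ g : Y → ℝ, Measurable g ∧ (∀ y, g y ∈ Set.Icc (0 : ℝ) 1) ∧
      g ∘ T =ᵐ[μ] μ[h | MeasurableSpace.comap T inferInstance] := by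
  have hle : MeasurableSpace.comap T inferInstance ≤ (inferInstance : MeasurableSpace X) :=
    hT.comap_le
  obtain ⟨g, hg, hgT⟩ :=
    (stronglyMeasurable_condExp (m := MeasurableSpace.comap T inferInstance) (μ := μ)
      (f := h)).measurable.exists_eq_measurable_comp
  refine ⟨fun y => max 0 (min 1 (g y)), measurable_const.max (measurable_const.min hg),
    fun y => ⟨le_max_left _ _, max_le zero_le_one (min_le_left _ _)⟩, ?_⟩
  have hnonneg : 0 ≤ᵐ[μ] g ∘ T := hgT ▸ condExp_nonneg (.of_forall fun x => (h01 x).1)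
  have hle_one : g ∘ T ≤ᵐ[μ] fun _ => 1 := by
    rw [← hgT, ← condExp_const (μ := μ) hle (1 : ℝ)]
    exact condExp_mono (integrable_of_mem_unitInterval hm h01)
      (integrable_const (1 : ℝ)) (.of_forall fun x => (h01 x).2)
  filter_upwards [hnonneg, hle_one] with x hx0 hx1
  rw [hgT]
  exact (congr_arg _ (min_eq_right hx1)).trans (max_eq_right hx0)

/-- If `μ` and `ν` agree where both have mass, then the lower boundary of their test region is the
polygonal line through `(0, 0)`, `(τ, 0)` and `(1, 1 - τ)`, where `τ` is their distance in total
variation. -/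
theorem isLeast_testRegion_of_restrict_eq [IsProbabilityMeasure μ] [IsProbabilityMeasure ν]
    {S T : Set X} (hS : MeasurableSet S) (hT : MeasurableSet T) (hμS : μ Sᶜ = 0)
    (hνT : ν Tᶜ = 0) (heq : μ.restrict T = ν.restrict S) {p : ℝ} (hp : p ∈ Set.Icc (0 : ℝ) 1) :
    IsLeast {v | (p, v) ∈ testRegion μ ν} (max 0 (p - μ.real Tᶜ)) := by
  have hμT : μ.real T = 1 - μ.real Tᶜ := by rw [probReal_compl_eq_one_sub hT]; ring
  refine ⟨mk_max_mem_of_convex convex_testRegion (mk_self_mem_testRegion (by simp)) ?_ ?_ hp,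
    fun v hv => max_le (testRegion_subset_Icc_prod_Icc hv).2.1 ?_⟩
  · simpa only [measureReal_def ν, hνT, ENNReal.toReal_zero] using
      measureReal_mem_testRegion (μ := μ) (ν := ν) hT.compl
  · have hμS1 : μ.real S = 1 := by
      rw [measureReal_def, (prob_compl_eq_zero_iff hS).1 hμS, ENNReal.toReal_one]
    have hνS : ν.real S = μ.real T := by
      rw [← measureReal_restrict_apply_univ, ← heq, measureReal_restrict_apply_univ]
    simpa only [hμS1, hνS, hμT] using measureReal_mem_testRegion (μ := μ) (ν := ν) hS
  · have hcommon := fst_le_of_mem_testRegion_of_common_le (ρ := μ.restrict T)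
      Measure.restrict_le_self (heq.trans_le Measure.restrict_le_self) hv
    rw [measureReal_restrict_apply_univ, hμT] at hcommon
    linarith

/-- A statistic through which the likelihood ratio factors is sufficient: conditioning on it turns
a test into one based on the statistic, with the same size and power. -/
theorem testRegion_map_withDensity_comp [IsFiniteMeasure μ] {T : X → Y} (hT : Measurable T)
    {c : Y → ℝ≥0} (hc : Measurable c)
    [IsFiniteMeasure (μ.withDensity fun x => (c (T x) : ℝ≥0∞))] :
    testRegion (μ.map T) ((μ.withDensity fun x => (c (T x) : ℝ≥0∞)).map T) =
      testRegion μ (μ.withDensity fun x => (c (T x) : ℝ≥0∞)) := by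
  refine (testRegion_map_subset hT).antisymm ?_
  rintro _ ⟨h, hm, h01, h1, h2⟩
  have hcT : Measurable fun x => c (T x) := hc.comp hT
  have hint := integrable_of_mem_unitInterval (μ := μ) hm h01
  have hint' := integrable_of_mem_unitInterval
    (μ := μ.withDensity fun x => (c (T x) : ℝ≥0∞)) hm h01
  rw [integrable_withDensity_iff_integrable_smul hcT] at hint'
  obtain ⟨g, hg, g01, hgT⟩ := exists_comp_ae_eq_condExp (μ := μ) hT hm h01
  refine ⟨g, hg, g01, ?_, ?_⟩
  · rw [integral_map hT.aemeasurable hg.aestronglyMeasurable, ← h1,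
      ← integral_condExp hT.comap_le (f := h)]
    exact integral_congr_ae hgT
  · have hpull : μ[fun x => (c (T x) : ℝ) * h x | MeasurableSpace.comap T inferInstance]
        =ᵐ[μ] fun x => (c (T x) : ℝ) * μ[h | MeasurableSpace.comap T inferInstance] x :=
      condExp_mul_of_stronglyMeasurable_left
        (measurable_coe_nnreal_real.comp (hc.comp (comap_measurable T))).stronglyMeasurable
        hint' hint
    rw [integral_map hT.aemeasurable hg.aestronglyMeasurable, ← h2,
      integral_withDensity_eq_integral_smul hcT,
      integral_withDensity_eq_integral_smul hcT]
    calc ∫ x, (c (T x) : ℝ) * g (T x) ∂μ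
        = ∫ x, (c (T x) : ℝ) * μ[h | MeasurableSpace.comap T inferInstance] x ∂μ :=
          integral_congr_ae (hgT.mono fun x hx => congr_arg (_ * ·) hx)
      _ = ∫ x, (c (T x) : ℝ) * h x ∂μ := by
          rw [← integral_congr_ae hpull, integral_condExp hT.comap_le]

end TestRegion

section Duality

variable {R : Set (ℝ × ℝ)} {p P : ℝ}

/-- If `v < p`, the segment from `(v, P)` to `(1, 1)` crosses the vertical line through `p` strictly
above `P`. -/
theorem le_of_mem_of_mem_upperBounds (hR : StarConvex ℝ (1, 1) R) (hp : p ≤ 1)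
    (hP : P ∈ upperBounds {w | (p, w) ∈ R}) (hP1 : P < 1) {v : ℝ} (hv : (v, P) ∈ R) : p ≤ v := by
  by_contra! hvp
  have hv1 : 0 < 1 - v := by linarith
  have hcross : (p, P + (p - v) / (1 - v) * (1 - P)) ∈ R := by
    convert hR hv (a := (p - v) / (1 - v)) (b := 1 - (p - v) / (1 - v))
      (div_nonneg (by linarith) hv1.le) (sub_nonneg.2 ((div_le_one hv1).2 (by linarith)))
      (by ring) using 1
    simp only [Prod.smul_mk, smul_eq_mul, Prod.mk_add_mk, Prod.mk.injEq]
    constructor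
    · field_simp
      ring
    · ring
  have habove : 0 < (p - v) / (1 - v) * (1 - P) :=
    mul_pos (div_pos (by linarith) hv1) (by linarith)
  linarith [hP hcross]

theorem isLeast_of_isGreatest_of_starConvex (hR : StarConvex ℝ (1, 1) R) (hp : p ≤ 1)
    (hP : IsGreatest {w | (p, w) ∈ R} P) (hP1 : P ≤ 1) (hone : ∀ u, (u, 1) ∈ R → 1 ≤ u) :
    IsLeast {u | (u, P) ∈ R} p := by
  refine ⟨hP.1, fun v hv => ?_⟩
  obtain rfl | hlt := hP1.eq_or_lt
  · exact hp.trans (hone v hv)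
  · exact le_of_mem_of_mem_upperBounds hR hp hP.2 hlt hv

theorem csInf_eq_of_eq_csSup_of_starConvex (hR : StarConvex ℝ (1, 1) R) (hp : p ≤ 1)
    (hne : {w | (p, w) ∈ R}.Nonempty) (hbdd : BddAbove {w | (p, w) ∈ R})
    (hP : sSup {w | (p, w) ∈ R} = P) (hP1 : P < 1) : sInf {u | (u, P) ∈ R} = p := by
  have hlub : IsLUB {w | (p, w) ∈ R} P := hP ▸ isLUB_csSup hne hbdd
  -- The segment from `(p, w)` to `(1, 1)` reaches the height `P` close to `p` when `w` is near `P`.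
  have hnear (w : ℝ) (hw : (p, w) ∈ R) : (p + (P - w) / (1 - w) * (1 - p), P) ∈ R := by
    have hwP : w ≤ P := hlub.1 hw
    have hw1 : 0 < 1 - w := by linarith
    convert hR hw (a := (P - w) / (1 - w)) (b := 1 - (P - w) / (1 - w))
      (div_nonneg (by linarith) hw1.le) (sub_nonneg.2 ((div_le_one hw1).2 (by linarith)))
      (by ring) using 1
    simp only [Prod.smul_mk, smul_eq_mul, Prod.mk_add_mk, Prod.mk.injEq]
    constructor
    · ring
    · field_simp
      ring
  refine IsGLB.csInf_eq ⟨fun v hv => le_of_mem_of_mem_upperBounds hR hp hlub.1 hP1 hv,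
    fun b hb => ?_⟩ (hne.imp' _ hnear)
  obtain ⟨w, -, -, hwP, hw⟩ := hlub.exists_seq_monotone_tendsto hne
  have hlim : Filter.Tendsto (fun n => p + (P - w n) / (1 - w n) * (1 - p)) .atTop
      (nhds (p + (P - P) / (1 - P) * (1 - p))) :=
    (((hwP.const_sub P).div (hwP.const_sub 1) (by linarith)).mul_const _).const_add p
  rw [sub_self, zero_div, zero_mul, add_zero] at hlim
  exact ge_of_tendsto' hlim fun n => hb (hnear _ (hw n))

end Duality

section Certificates

variable {X : Type*} [MeasurableSpace X] {ξ : X → Measure X} {B B' : X → Set X} {x y : X}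
  {p v P : ℝ}

/-- The union of the test regions of `ξ x` against `ξ x'` for `x'` in the ball around `x`; its
vertical sections are the sets `certValues ξ B x p`. -/
def certRegion (ξ : X → Measure X) (B : X → Set X) (x : X) : Set (ℝ × ℝ) :=
  ⋃ x' ∈ B x, testRegion (ξ x) (ξ x')

theorem mk_mem_certRegion : (p, v) ∈ certRegion ξ B x ↔ v ∈ certValues ξ B x p := by
  simp only [certRegion, Set.mem_iUnion, exists_prop, mem_certValues]

theorem self_mem_certValues [∀ x, IsProbabilityMeasure (ξ x)] (hx : x ∈ B x)
    (hp : p ∈ Set.Icc (0 : ℝ) 1) : p ∈ certValues ξ B x p :=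
  ⟨x, hx, mk_self_mem_testRegion hp⟩

theorem certValues_subset_Icc [∀ x, IsProbabilityMeasure (ξ x)] :
    certValues ξ B x p ⊆ Set.Icc 0 1 := by
  intro v hv
  obtain ⟨x', -, hmem⟩ := mem_certValues.1 hv
  exact (testRegion_subset_Icc_prod_Icc hmem).2

theorem one_sub_mem_certValues [∀ x, IsProbabilityMeasure (ξ x)] :
    1 - v ∈ certValues ξ B x (1 - p) ↔ v ∈ certValues ξ B x p :=
  exists_congr fun _ => and_congr_right fun _ => one_sub_mem_testRegion

theorem isGreatest_certValues_of_isLeast [∀ x, IsProbabilityMeasure (ξ x)]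
    (h : IsLeast (certValues ξ B x (1 - p)) (1 - v)) : IsGreatest (certValues ξ B x p) v :=
  ⟨one_sub_mem_certValues.1 h.1, fun _ hw => sub_le_sub_iff_left 1 |>.1 <|
    h.2 (one_sub_mem_certValues.2 hw)⟩

theorem starConvex_certRegion [∀ x, IsProbabilityMeasure (ξ x)] :
    StarConvex ℝ (1, 1) (certRegion ξ B x) :=
  starConvex_iUnion₂ fun _ _ =>
    convex_testRegion.starConvex (mk_self_mem_testRegion (Set.right_mem_Icc.2 zero_le_one))

theorem certValues_eq_singleton_of_subsingleton [Subsingleton X]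
    [∀ x, IsProbabilityMeasure (ξ x)] (hx : x ∈ B x) (hp : p ∈ Set.Icc (0 : ℝ) 1) :
    certValues ξ B x p = {p} := by
  refine Set.Subset.antisymm ?_ (Set.singleton_subset_iff.2 (self_mem_certValues hx hp))
  rintro v ⟨x', -, h, -, -, h1, h2⟩
  rw [Set.mem_singleton_iff, ← h1, ← h2, Subsingleton.elim x' x]

theorem certValues_eq_singleton_of_absolutelyContinuous [∀ x, IsProbabilityMeasure (ξ x)]
    (hac : ∀ x x', ξ x' ≪ ξ x) (hx : x ∈ B x) (hp : p = 0 ∨ p = 1) :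
    certValues ξ B x p = {p} := by
  have hp01 : p ∈ Set.Icc (0 : ℝ) 1 := by obtain rfl | rfl := hp <;> simp
  refine Set.Subset.antisymm ?_ (Set.singleton_subset_iff.2 (self_mem_certValues hx hp01))
  rintro v ⟨x', -, hv⟩
  obtain rfl | rfl := hp
  · exact eq_zero_of_zero_mem_testRegion (hac x x') hv
  · exact eq_one_of_one_mem_testRegion (hac x x') hv

theorem certLower_certUpper_of_isGreatest_of_isLeast (hU : IsGreatest (certValues ξ B' y p) P)
    (hL : IsLeast (certValues ξ B x P) p) : certLower ξ B x (certUpper ξ B' y p) = p := by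
  rw [certUpper, hU.csSup_eq, certLower, hL.csInf_eq]

theorem certLower_certUpper_of_eq_singleton (hU : certValues ξ B' y p = {p})
    (hL : certValues ξ B x p = {p}) : certLower ξ B x (certUpper ξ B' y p) = p :=
  certLower_certUpper_of_isGreatest_of_isLeast (hU ▸ isGreatest_singleton)
    (hL ▸ isLeast_singleton)

theorem certLower_certUpper_of_swap [∀ x, IsProbabilityMeasure (ξ x)]
    (hswap : ∀ u w, (u, w) ∈ certRegion ξ B x ↔ (w, u) ∈ certRegion ξ B' y) (hy : y ∈ B' y)
    (hp : p ∈ Set.Icc (0 : ℝ) 1) (h1 : certUpper ξ B' y p < 1) :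
    certLower ξ B x (certUpper ξ B' y p) = p := by
  have hsection : {w | (p, w) ∈ certRegion ξ B' y} = certValues ξ B' y p :=
    Set.ext fun _ => mk_mem_certRegion
  have hdual := csInf_eq_of_eq_csSup_of_starConvex (starConvex_certRegion (ξ := ξ) (B := B'))
    hp.2 (hsection ▸ ⟨p, self_mem_certValues hy hp⟩)
    (hsection ▸ bddAbove_Icc.mono certValues_subset_Icc) (hsection ▸ rfl) h1
  simpa only [← hswap, mk_mem_certRegion, Set.ofPred_mem_eq, certLower] using hdual

end Certificates

section Translation

variable {X : Type*} [AddCommGroup X] [MeasurableSpace X] [MeasurableAdd X] {ξ : X → Measure X}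
  {B : X → Set X}

theorem testRegion_add_left (hξ : ∀ t x, ξ (t + x) = (ξ x).map (t + ·)) (t x x' : X) :
    testRegion (ξ (t + x)) (ξ (t + x')) = testRegion (ξ x) (ξ x') := by
  rw [hξ, hξ]
  exact testRegion_map_equiv (MeasurableEquiv.addLeft t)

theorem mk_mem_certRegion_iff_swap (hξ : ∀ t x, ξ (t + x) = (ξ x).map (t + ·))
    (hB : ∀ t x x', t + x' ∈ B (t + x) ↔ x' ∈ B x) (x y : X) (u w : ℝ) :
    (u, w) ∈ certRegion ξ B x ↔ (w, u) ∈ certRegion ξ (invBall B) y := by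
  simp only [certRegion, Set.mem_iUnion, exists_prop]
  constructor
  · rintro ⟨x', hx', h⟩
    have hy : y - x' + x' = y := sub_add_cancel y x'
    refine ⟨y - x' + x, ?_, ?_⟩
    · simpa only [hy, invBall] using! (hB (y - x') x x').2 hx'
    · simpa only [hy] using (testRegion_add_left hξ (y - x') x' x).ge (testRegion_swap.1 h)
  · rintro ⟨y', hy', h⟩
    have hx : x - y' + y' = x := sub_add_cancel x y'
    refine ⟨x - y' + y, ?_, ?_⟩
    · simpa only [hx] using (hB (x - y') y' y).2 hy'
    · simpa only [hx] using (testRegion_add_left hξ (x - y') y' y).ge (testRegion_swap.1 h)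

theorem certLower_certUpper_of_translation [∀ x, IsProbabilityMeasure (ξ x)]
    (hξ : ∀ t x, ξ (t + x) = (ξ x).map (t + ·))
    (hB : ∀ t x x', t + x' ∈ B (t + x) ↔ x' ∈ B x) (x : X) {y : X} (hy : y ∈ B y) {p : ℝ}
    (hp : p ∈ Set.Icc (0 : ℝ) 1) (h1 : certUpper ξ (invBall B) y p < 1) :
    certLower ξ B x (certUpper ξ (invBall B) y p) = p :=
  certLower_certUpper_of_swap (mk_mem_certRegion_iff_swap hξ hB x y) hy hp h1

end Translation

section Balls

variable {d : ℕ} {q : ℝ≥0∞} [Fact (1 ≤ q)] {r : ℝ}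

theorem invBall_lpBall (q : ℝ≥0∞) [Fact (1 ≤ q)] (r : ℝ) :
    invBall (lpBall (d := d) q r) = lpBall q r := by
  ext x y
  simp only [invBall, lpBall, Set.mem_ofPred_eq]
  rw [← neg_sub, WithLp.toLp_neg, norm_neg]

theorem invBall_sparseBall (ra rd : ℕ) :
    invBall (sparseBall (d := d) ra rd) = sparseBall rd ra := by
  ext x y
  simp only [invBall, sparseBall, Set.mem_ofPred_eq, and_comm]

theorem self_mem_lpBall (hr : 0 ≤ r) (x : Fin d → ℝ) : x ∈ lpBall q r x := by
  simp [lpBall, hr]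

theorem add_single_mem_lpBall {s : ℝ} (hs : |s| ≤ r) (x : Fin d → ℝ) (i : Fin d) :
    x + Pi.single i s ∈ lpBall q r x := by
  rw [lpBall, Set.mem_ofPred_eq, add_sub_cancel_left]
  exact (PiLp.norm_single q (fun _ : Fin d => ℝ) i s).trans_le hs

theorem add_mem_lpBall_add_left {q : ℝ≥0∞} (t x x' : Fin d → ℝ) :
    t + x' ∈ lpBall q r (t + x) ↔ x' ∈ lpBall q r x := by
  simp only [lpBall, Set.mem_ofPred_eq, add_sub_add_left_eq_sub]

theorem norm_toLp_le_norm_toLp_of_le {ι E : Type*} [Fintype ι] [SeminormedAddCommGroup E]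
    {p q : ℝ≥0∞} [Fact (1 ≤ p)] [Fact (1 ≤ q)] (hpq : p ≤ q) (a : ι → E) :
    ‖WithLp.toLp q a‖ ≤ ‖WithLp.toLp p a‖ := by
  obtain rfl | hq_top := eq_or_ne q ∞
  · rw [PiLp.norm_eq_ciSup]
    exact Real.iSup_le (PiLp.norm_apply_le (WithLp.toLp p a)) (norm_nonneg _)
  have hpos {s : ℝ≥0∞} [Fact (1 ≤ s)] (hs : s ≠ ∞) : 0 < s.toReal :=
    ENNReal.toReal_pos (zero_lt_one.trans_le (Fact.out : 1 ≤ s)).ne' hs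
  have hp := hpos (ne_top_of_le_ne_top hq_top hpq)
  have hq := hpos hq_top
  have hpq' : 0 ≤ q.toReal - p.toReal := sub_nonneg.2 (ENNReal.toReal_mono hq_top hpq)
  have hsum {s : ℝ≥0∞} [Fact (1 ≤ s)] (hs : 0 < s.toReal) :
      ‖WithLp.toLp s a‖ ^ s.toReal = ∑ i, ‖a i‖ ^ s.toReal := by
    rw [PiLp.norm_eq_sum hs, one_div, Real.rpow_inv_rpow (by positivity) hs.ne']
  refine (Real.rpow_le_rpow_iff (norm_nonneg _) (norm_nonneg _) hq).1 ?_
  calc ‖WithLp.toLp q a‖ ^ q.toReal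
      = ∑ i, ‖a i‖ ^ (q.toReal - p.toReal) * ‖a i‖ ^ p.toReal := by
        simp only [hsum hq, ← Real.rpow_add_of_nonneg (norm_nonneg _) hpq' hp.le, sub_add_cancel]
    _ ≤ ∑ i, ‖WithLp.toLp p a‖ ^ (q.toReal - p.toReal) * ‖a i‖ ^ p.toReal := by
        gcongr with i
        exact PiLp.norm_apply_le (WithLp.toLp p a) i
    _ = ‖WithLp.toLp p a‖ ^ q.toReal := by
        rw [← Finset.mul_sum, ← hsum hp, ← Real.rpow_add_of_nonneg (norm_nonneg _) hpq' hp.le,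
          sub_add_cancel]

end Balls

section Cdf

theorem strictMono_cdf (μ : Measure ℝ) [IsProbabilityMeasure μ] [μ.IsOpenPosMeasure] :
    StrictMono (cdf μ) := by
  intro s t hst
  have hIoc : 0 < μ.real (Set.Ioc s t) :=
    ENNReal.toReal_pos (((Measure.measure_Ioo_pos μ).2 hst).trans_le
      (measure_mono Set.Ioo_subset_Ioc_self)).ne' (measure_ne_top μ _)
  rw [cdf_eq_real, cdf_eq_real, ← Set.Iic_union_Ioc_eq_Iic hst.le,
    measureReal_union (Set.Iic_disjoint_Ioc le_rfl) measurableSet_Ioc]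
  linarith

theorem continuous_cdf (μ : Measure ℝ) [IsProbabilityMeasure μ] [NullSingletonClass μ] :
    Continuous (cdf μ) := by
  refine continuous_iff_continuousAt.2 fun t =>
    (monotone_cdf μ).continuousAt_iff_leftLim_eq_rightLim.2 ?_
  have hjump := (cdf μ).measure_singleton t
  rw [measure_cdf, measure_singleton, eq_comm, ENNReal.ofReal_eq_zero, sub_nonpos] at hjump
  rw [(cdf μ).rightLim_eq]
  exact ((monotone_cdf μ).leftLim_le le_rfl).antisymm hjump

theorem cdf_sInf_le_cdf_eq (μ : Measure ℝ) [IsProbabilityMeasure μ] [NullSingletonClass μ]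
    [μ.IsOpenPosMeasure] {p : ℝ} (hp : p ∈ Set.Ioo (0 : ℝ) 1) :
    cdf μ (sInf {t | p ≤ cdf μ t}) = p := by
  obtain ⟨t, rfl⟩ : p ∈ Set.range (cdf μ) :=
    mem_range_of_exists_le_of_exists_ge (continuous_cdf μ)
      (((tendsto_cdf_atBot μ).eventually_le_const hp.1).exists)
      (((tendsto_cdf_atTop μ).eventually_const_le hp.2).exists)
  rw [show {s | cdf μ t ≤ cdf μ s} = Set.Ici t from
    Set.ext fun _ => (strictMono_cdf μ).le_iff_le, csInf_Ici]

end Cdf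

section GaussCDF

variable {σ : ℝ≥0}

theorem gaussCDF_eq_real (σ : ℝ≥0) (t : ℝ) :
    gaussCDF σ t = (gaussianReal 0 (σ ^ 2)).real (Set.Iic t) := cdf_eq_real _ _

theorem monotone_gaussCDF (σ : ℝ≥0) : Monotone (gaussCDF σ) := monotone_cdf _

theorem gaussCDF_gaussQuantile (hσ : σ ≠ 0) {p : ℝ} (hp : p ∈ Set.Ioo (0 : ℝ) 1) :
    gaussCDF σ (gaussQuantile σ p) = p := by
  have hσ2 : σ ^ 2 ≠ 0 := pow_ne_zero 2 hσ
  have := nullSingletonClass_gaussianReal (μ := 0) hσ2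
  have := (gaussianReal_absolutelyContinuous' 0 hσ2).isOpenPosMeasure
  exact cdf_sInf_le_cdf_eq (gaussianReal 0 (σ ^ 2)) hp

theorem gaussCDF_neg (hσ : σ ≠ 0) (t : ℝ) : gaussCDF σ (-t) = 1 - gaussCDF σ t := by
  have := nullSingletonClass_gaussianReal (μ := 0) (pow_ne_zero 2 hσ)
  have hsymm : (gaussianReal 0 (σ ^ 2)).map (-·) = gaussianReal 0 (σ ^ 2) := by
    rw [gaussianReal_map_neg, neg_zero]
  rw [gaussCDF_eq_real, gaussCDF_eq_real, ← probReal_compl_eq_one_sub measurableSet_Iic,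
    Set.compl_Iic, measureReal_congr Ioi_ae_eq_Ici]
  nth_rw 1 [← hsymm]
  rw [map_measureReal_apply measurable_neg measurableSet_Iic]
  simp

end GaussCDF

section GaussianLaws

theorem pi_withDensity {ι : Type*} [Fintype ι] {Ω : ι → Type*} [∀ i, MeasurableSpace (Ω i)]
    (μ : ∀ i, Measure (Ω i)) [∀ i, IsProbabilityMeasure (μ i)] {f : ∀ i, Ω i → ℝ≥0∞}
    (hf : ∀ i, Measurable (f i)) [∀ i, SigmaFinite ((μ i).withDensity (f i))] :
    Measure.pi (fun i => (μ i).withDensity (f i)) =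
      (Measure.pi μ).withDensity fun z => ∏ i, f i (z i) := by
  refine Measure.pi_eq fun s hs => ?_
  have hm (i : ι) : Measurable ((s i).indicator (f i)) := (hf i).indicator (hs i)
  have hprod (z : ∀ i, Ω i) : (Set.univ.pi s).indicator (fun z => ∏ i, f i (z i)) z =
      ∏ i, (s i).indicator (f i) (z i) := by
    classical
    simp only [Set.indicator_apply, Set.mem_univ_pi, Finset.prod_ite_zero, Finset.mem_univ,
      true_imp_iff]
  calc (Measure.pi μ).withDensity (fun z => ∏ i, f i (z i)) (Set.univ.pi s)
      = ∫⁻ z, ∏ i, (s i).indicator (f i) (z i) ∂Measure.pi μ := by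
        rw [withDensity_apply _ (.univ_pi hs), ← lintegral_indicator (.univ_pi hs)]
        exact lintegral_congr hprod
    _ = ∏ i, ∫⁻ z, (s i).indicator (f i) (z i) ∂Measure.pi μ :=
        lintegral_prod_eq_prod_lintegral_of_indepFun Finset.univ
          (fun i (z : ∀ i, Ω i) => (s i).indicator (f i) (z i))
          (iIndepFun_pi fun i => (hm i).aemeasurable)
          fun i => (hm i).comp (measurable_pi_apply i)
    _ = ∏ i, (μ i).withDensity (f i) (s i) := by
        refine Finset.prod_congr rfl fun i _ => ?_
        rw [withDensity_apply _ (hs i), ← lintegral_indicator (hs i)]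
        exact (measurePreserving_eval μ i).lintegral_comp (hm i)

theorem map_sum_pi_gaussianReal {ι : Type*} [Fintype ι] (m : ι → ℝ) (v : ι → ℝ≥0) :
    (Measure.pi fun i => gaussianReal (m i) (v i)).map (fun z => ∑ i, z i) =
      gaussianReal (∑ i, m i) (∑ i, v i) := by
  have hsum : Measurable fun z : ι → ℝ => ∑ i, z i := by fun_prop
  have := Measure.isProbabilityMeasure_map
    (μ := Measure.pi fun i => gaussianReal (m i) (v i)) hsum.aemeasurable
  refine Measure.ext_of_charFun ?_
  rw [charFun_map_sum_pi_eq_prod]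
  ext t
  simp only [Finset.prod_apply, charFun_gaussianReal, ← Complex.exp_sum]
  congr 1
  push_cast
  simp only [Finset.sum_sub_distrib, Finset.mul_sum, Finset.sum_mul, Finset.sum_div]

/-- The likelihood ratio at `t` of `N(a, v)` to `N(0, v)`. -/
noncomputable def gaussianRatio (v : ℝ≥0) (a t : ℝ) : ℝ≥0 :=
  Real.toNNReal (Real.exp ((a * t - a ^ 2 / 2) / v))

theorem measurable_gaussianRatio (v : ℝ≥0) (a : ℝ) : Measurable (gaussianRatio v a) := by
  unfold gaussianRatio
  fun_prop

theorem monotone_gaussianRatio (v : ℝ≥0) {a : ℝ} (ha : 0 ≤ a) : Monotone (gaussianRatio v a) := by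
  intro s t hst
  unfold gaussianRatio
  gcongr

theorem prod_gaussianRatio {ι : Type*} [Fintype ι] (v : ℝ≥0) (n : ℝ) {u : ι → ℝ}
    (hu : ∑ i, u i ^ 2 = 1) (t : ι → ℝ) :
    ∏ i, gaussianRatio v (n * u i) (t i) = gaussianRatio v n (∑ i, u i * t i) := by
  simp only [gaussianRatio]
  rw [← Real.toNNReal_prod_of_nonneg fun _ _ => (Real.exp_pos _).le, ← Real.exp_sum,
    ← Finset.sum_div, Finset.sum_sub_distrib, ← Finset.sum_div]
  simp only [mul_pow, ← Finset.mul_sum, hu, mul_one, mul_assoc]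

theorem gaussianReal_add_eq_withDensity {v : ℝ≥0} (hv : v ≠ 0) (m a : ℝ) :
    gaussianReal (m + a) v =
      (gaussianReal m v).withDensity fun z => (gaussianRatio v a (z - m) : ℝ≥0∞) := by
  have hratio : Measurable fun z => (gaussianRatio v a (z - m) : ℝ≥0∞) :=
    ((measurable_gaussianRatio v a).comp (measurable_id.sub_const m)).coe_nnreal_ennreal
  rw [gaussianReal_of_var_ne_zero _ hv, gaussianReal_of_var_ne_zero _ hv,
    ← withDensity_mul _ (measurable_gaussianPDF _ _) hratio]
  congr 1
  ext1 z
  rw [Pi.mul_apply, gaussianPDF, gaussianPDF, gaussianRatio, ← ENNReal.ofReal,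
    ← ENNReal.ofReal_mul (gaussianPDFReal_nonneg _ _ _), gaussianPDFReal, gaussianPDFReal,
    mul_assoc (√_)⁻¹, ← Real.exp_add]
  congr 3
  have : (v : ℝ) ≠ 0 := NNReal.coe_ne_zero.2 hv
  field_simp
  ring

end GaussianLaws

section GaussianSmoothing

variable {d : ℕ} {σ : ℝ≥0} {q : ℝ≥0∞} {r p : ℝ}

theorem gaussianScheme_eq_pi (σ : ℝ≥0) (x : Fin d → ℝ) :
    gaussianScheme σ x = Measure.pi fun i => gaussianReal (x i) (σ ^ 2) := by
  have hshift (i : Fin d) :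
      (gaussianReal 0 (σ ^ 2)).map (x i + ·) = gaussianReal (x i) (σ ^ 2) := by
    rw [gaussianReal_map_const_add, zero_add]
  have (i : Fin d) : SigmaFinite ((gaussianReal 0 (σ ^ 2)).map (x i + ·)) := by
    rw [hshift]; infer_instance
  simp only [← hshift]
  exact Measure.pi_map_pi (f := fun i e => x i + e) fun i => by fun_prop

instance isProbabilityMeasure_gaussianScheme (x : Fin d → ℝ) :
    IsProbabilityMeasure (gaussianScheme σ x) := by
  rw [gaussianScheme_eq_pi]; infer_instance

theorem gaussianScheme_add_eq_withDensity (hσ : σ ≠ 0) (x a : Fin d → ℝ) :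
    gaussianScheme σ (x + a) = (gaussianScheme σ x).withDensity
      fun z => ((∏ i, gaussianRatio (σ ^ 2) (a i) (z i - x i) : ℝ≥0) : ℝ≥0∞) := by
  have hcoord (i : Fin d) := gaussianReal_add_eq_withDensity (pow_ne_zero 2 hσ) (x i) (a i)
  have (i : Fin d) : SigmaFinite ((gaussianReal (x i) (σ ^ 2)).withDensity
      fun z => (gaussianRatio (σ ^ 2) (a i) (z - x i) : ℝ≥0∞)) := by
    rw [← hcoord]; infer_instance
  rw [gaussianScheme_eq_pi, gaussianScheme_eq_pi]
  simp only [Pi.add_apply, hcoord, ENNReal.ofNNReal_finsetProd]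
  exact pi_withDensity _ fun i => ((measurable_gaussianRatio (σ ^ 2) (a i)).comp
    (measurable_id.sub_const (x i))).coe_nnreal_ennreal

theorem gaussianScheme_absolutelyContinuous (hσ : σ ≠ 0) (x x' : Fin d → ℝ) :
    gaussianScheme σ x' ≪ gaussianScheme σ x := by
  rw [← add_sub_cancel x x', gaussianScheme_add_eq_withDensity hσ]
  exact withDensity_absolutelyContinuous _ _

theorem map_gaussianScheme_add_smul (σ : ℝ≥0) (x : Fin d → ℝ) {u : Fin d → ℝ}
    (hu : ∑ i, u i ^ 2 = 1) (n : ℝ) :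
    (gaussianScheme σ (x + n • u)).map (fun z => ∑ i, u i * (z i - x i)) =
      gaussianReal n (σ ^ 2) := by
  have hcoord (i : Fin d) : (gaussianReal (x i + n * u i) (σ ^ 2)).map (fun t => u i * (t - x i)) =
      gaussianReal (n * u i ^ 2) (.mk (u i ^ 2) (sq_nonneg _) * σ ^ 2) := by
    calc (gaussianReal (x i + n * u i) (σ ^ 2)).map (fun t => u i * (t - x i))
        = ((gaussianReal (x i + n * u i) (σ ^ 2)).map (· - x i)).map (u i * ·) :=
          (Measure.map_map (by fun_prop) (by fun_prop)).symm
      _ = _ := by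
          rw [gaussianReal_map_sub_const, gaussianReal_map_const_mul]
          congr 1
          ring
  have (i : Fin d) : SigmaFinite
      ((gaussianReal (x i + n * u i) (σ ^ 2)).map fun t => u i * (t - x i)) := by
    rw [hcoord]; infer_instance
  have hu' : ∑ i, (.mk (u i ^ 2) (sq_nonneg _) : ℝ≥0) = 1 := NNReal.eq (by push_cast; exact hu)
  calc (gaussianScheme σ (x + n • u)).map (fun z => ∑ i, u i * (z i - x i))
      = ((gaussianScheme σ (x + n • u)).map fun z i => u i * (z i - x i)).map
          fun z => ∑ i, z i :=
        (Measure.map_map (g := fun z : Fin d → ℝ => ∑ i, z i)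
          (f := fun (z : Fin d → ℝ) i => u i * (z i - x i)) (by fun_prop) (by fun_prop)).symm
    _ = (Measure.pi fun i => gaussianReal (n * u i ^ 2) (.mk (u i ^ 2) (sq_nonneg _) * σ ^ 2)).map
          fun z => ∑ i, z i := by
        rw [gaussianScheme_eq_pi]
        simp only [← hcoord]
        rw [← Measure.pi_map_pi (f := fun i t => u i * (t - x i)) fun i => by fun_prop]
        rfl
    _ = gaussianReal n (σ ^ 2) := by
        rw [map_sum_pi_gaussianReal, ← Finset.mul_sum, hu, mul_one, ← Finset.sum_mul, hu',
          one_mul]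

/-- The displacement is the only direction that matters: the coordinate along it is a sufficient
statistic. -/
theorem testRegion_gaussianScheme_add_smul (hσ : σ ≠ 0) (x : Fin d → ℝ) {u : Fin d → ℝ}
    (hu : ∑ i, u i ^ 2 = 1) (n : ℝ) :
    testRegion (gaussianScheme σ x) (gaussianScheme σ (x + n • u)) =
      testRegion (gaussianReal 0 (σ ^ 2)) (gaussianReal n (σ ^ 2)) := by
  have hdensity := gaussianScheme_add_eq_withDensity hσ x (n • u)
  simp only [Pi.smul_apply, smul_eq_mul, prod_gaussianRatio (σ ^ 2) n hu] at hdensity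
  have : IsFiniteMeasure ((gaussianScheme σ x).withDensity fun z =>
      (gaussianRatio (σ ^ 2) n (∑ i, u i * (z i - x i)) : ℝ≥0∞)) := by
    rw [← hdensity]; infer_instance
  have hsufficient := testRegion_map_withDensity_comp (μ := gaussianScheme σ x)
    (T := fun z => ∑ i, u i * (z i - x i)) (by fun_prop) (measurable_gaussianRatio (σ ^ 2) n)
  have hzero := map_gaussianScheme_add_smul σ x hu 0
  rw [zero_smul, add_zero] at hzero
  rw [← hdensity, map_gaussianScheme_add_smul σ x hu, hzero] at hsufficient
  exact hsufficient.symm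

theorem isLeast_testRegion_gaussianReal (hσ : σ ≠ 0) {n : ℝ} (hn : 0 ≤ n) (t : ℝ) :
    IsLeast {v | (gaussCDF σ t, v) ∈
      testRegion (gaussianReal 0 (σ ^ 2)) (gaussianReal n (σ ^ 2))} (gaussCDF σ (t - n)) := by
  have hdensity := gaussianReal_add_eq_withDensity (pow_ne_zero 2 hσ) 0 n
  have hshift : gaussianReal n (σ ^ 2) = (gaussianReal 0 (σ ^ 2)).map (n + ·) := by
    rw [gaussianReal_map_const_add, zero_add]
  have hpower : gaussCDF σ (t - n) = (gaussianReal n (σ ^ 2)).real (Set.Iic t) := by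
    rw [hshift, map_measureReal_apply (by fun_prop) measurableSet_Iic, gaussCDF_eq_real]
    simp
  simp only [zero_add, sub_zero] at hdensity
  have : IsFiniteMeasure ((gaussianReal 0 (σ ^ 2)).withDensity
      fun z => (gaussianRatio (σ ^ 2) n z : ℝ≥0∞)) := by
    rw [← hdensity]; infer_instance
  rw [hpower, gaussCDF_eq_real, hdensity]
  have hmono := monotone_gaussianRatio (σ ^ 2) hn
  exact isLeast_testRegion_withDensity measurableSet_Iic (k := gaussianRatio (σ ^ 2) n t)
    (fun z hz => ENNReal.coe_le_coe.2 (hmono hz))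
    fun z hz => ENNReal.coe_le_coe.2 (hmono (not_le.1 hz).le)

theorem exists_eq_add_norm_smul (hd : 0 < d) (x x' : Fin d → ℝ) :
    ∃ u : Fin d → ℝ, ∑ i, u i ^ 2 = 1 ∧ x' = x + ‖WithLp.toLp 2 (x' - x)‖ • u := by
  obtain rfl | hne := eq_or_ne x' x
  · exact ⟨Pi.single ⟨0, hd⟩ 1, by simp [Pi.single_apply], by simp⟩
  · have hnorm : ‖WithLp.toLp 2 (x' - x)‖ ≠ 0 := by simpa [sub_eq_zero] using hne
    refine ⟨‖WithLp.toLp 2 (x' - x)‖⁻¹ • (x' - x), ?_, ?_⟩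
    · simp only [Pi.smul_apply, smul_eq_mul, mul_pow, ← Finset.mul_sum]
      rw [← EuclideanSpace.real_norm_sq_eq (WithLp.toLp 2 (x' - x)), ← mul_pow,
        inv_mul_cancel₀ hnorm, one_pow]
    · rw [smul_inv_smul₀ hnorm, add_sub_cancel]

theorem isLeast_certValues_gaussian_gaussCDF [Fact (1 ≤ q)] (hσ : σ ≠ 0) (hq : q ≤ 2) (hr : 0 ≤ r)
    (hd : 0 < d) (x : Fin d → ℝ) (t : ℝ) :
    IsLeast (certValues (gaussianScheme σ) (lpBall q r) x (gaussCDF σ t))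
      (gaussCDF σ (t - r)) := by
  have hleast {u : Fin d → ℝ} (hu : ∑ i, u i ^ 2 = 1) {n : ℝ} (hn : 0 ≤ n) :=
    testRegion_gaussianScheme_add_smul hσ x hu n ▸ isLeast_testRegion_gaussianReal hσ hn t
  refine ⟨?_, ?_⟩
  · have hu : ∑ i, (Pi.single ⟨0, hd⟩ 1 : Fin d → ℝ) i ^ 2 = 1 := by simp [Pi.single_apply]
    have hmem := add_single_mem_lpBall (q := q) (abs_of_nonneg hr).le x ⟨0, hd⟩
    rw [← mul_one r, ← smul_eq_mul, Pi.single_smul, smul_eq_mul, mul_one] at hmem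
    exact mem_certValues.2 ⟨_, hmem, (hleast hu hr).1⟩
  · rintro v ⟨x', hx', hv⟩
    obtain ⟨u, hu, hxu⟩ := exists_eq_add_norm_smul hd x x'
    have hnr : ‖WithLp.toLp 2 (x' - x)‖ ≤ r := (norm_toLp_le_norm_toLp_of_le hq _).trans hx'
    rw [hxu] at hv
    exact (monotone_gaussCDF σ (by linarith)).trans ((hleast hu (norm_nonneg _)).2 hv)

theorem isLeast_certValues_gaussian [Fact (1 ≤ q)] (hσ : σ ≠ 0) (hq : q ≤ 2) (hr : 0 ≤ r)
    (hd : 0 < d) (x : Fin d → ℝ) (hp : p ∈ Set.Ioo (0 : ℝ) 1) :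
    IsLeast (certValues (gaussianScheme σ) (lpBall q r) x p)
      (gaussCDF σ (gaussQuantile σ p - r)) := by
  simpa only [gaussCDF_gaussQuantile hσ hp] using
    isLeast_certValues_gaussian_gaussCDF hσ hq hr hd x (gaussQuantile σ p)

theorem isGreatest_certValues_gaussian_gaussCDF [Fact (1 ≤ q)] (hσ : σ ≠ 0) (hq : q ≤ 2)
    (hr : 0 ≤ r) (hd : 0 < d) (x : Fin d → ℝ) (t : ℝ) :
    IsGreatest (certValues (gaussianScheme σ) (lpBall q r) x (gaussCDF σ t))
      (gaussCDF σ (t + r)) := by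
  refine isGreatest_certValues_of_isLeast ?_
  rw [← gaussCDF_neg hσ, ← gaussCDF_neg hσ, neg_add']
  exact isLeast_certValues_gaussian_gaussCDF hσ hq hr hd x (-t)

theorem isGreatest_certValues_gaussian [Fact (1 ≤ q)] (hσ : σ ≠ 0) (hq : q ≤ 2) (hr : 0 ≤ r)
    (hd : 0 < d) (x : Fin d → ℝ) (hp : p ∈ Set.Ioo (0 : ℝ) 1) :
    IsGreatest (certValues (gaussianScheme σ) (lpBall q r) x p)
      (gaussCDF σ (gaussQuantile σ p + r)) := by
  simpa only [gaussCDF_gaussQuantile hσ hp] using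
    isGreatest_certValues_gaussian_gaussCDF hσ hq hr hd x (gaussQuantile σ p)

theorem certLower_certUpper_gaussian [Fact (1 ≤ q)] (hσ : σ ≠ 0) (hq : q ≤ 2) (hr : 0 ≤ r)
    (x y : Fin d → ℝ) (hp : p ∈ Set.Icc (0 : ℝ) 1) :
    certLower (gaussianScheme σ) (lpBall q r) x
      (certUpper (gaussianScheme σ) (invBall (lpBall q r)) y p) = p := by
  rw [invBall_lpBall]
  obtain rfl | hd := d.eq_zero_or_pos
  · exact certLower_certUpper_of_eq_singleton
      (certValues_eq_singleton_of_subsingleton (self_mem_lpBall hr y) hp)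
      (certValues_eq_singleton_of_subsingleton (self_mem_lpBall hr x) hp)
  by_cases hp' : p = 0 ∨ p = 1
  · have hac := gaussianScheme_absolutelyContinuous (d := d) hσ
    exact certLower_certUpper_of_eq_singleton
      (certValues_eq_singleton_of_absolutelyContinuous hac (self_mem_lpBall hr y) hp')
      (certValues_eq_singleton_of_absolutelyContinuous hac (self_mem_lpBall hr x) hp')
  · obtain ⟨hp0, hp1⟩ := not_or.1 hp'
    have hmem : p ∈ Set.Ioo (0 : ℝ) 1 := ⟨hp.1.lt_of_ne' hp0, hp.2.lt_of_ne hp1⟩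
    refine certLower_certUpper_of_isGreatest_of_isLeast
      (isGreatest_certValues_gaussian hσ hq hr hd y hmem) ?_
    simpa only [add_sub_cancel_right, gaussCDF_gaussQuantile hσ hmem] using
      isLeast_certValues_gaussian_gaussCDF hσ hq hr hd x (gaussQuantile σ p + r)

end GaussianSmoothing

section UniformLaws

theorem cond_restrict_comm {X : Type*} [MeasurableSpace X] {μ : Measure X} {s t : Set X}
    (hs : MeasurableSet s) (ht : MeasurableSet t) (hst : μ s = μ t) :
    (cond μ s).restrict t = (cond μ t).restrict s := by
  simp only [ProbabilityTheory.cond, Measure.restrict_smul, Measure.restrict_restrict hs,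
    Measure.restrict_restrict ht, hst, Set.inter_comm]

theorem map_add_left_cond {G : Type*} [AddGroup G] [MeasurableSpace G] [MeasurableAdd G]
    (μ : Measure G) [μ.IsAddLeftInvariant] (a : G) {s : Set G} (hs : MeasurableSet s) :
    (cond μ ((a + ·) ⁻¹' s)).map (a + ·) = cond μ s := by
  rw [ProbabilityTheory.cond, ProbabilityTheory.cond, Measure.map_smul, measure_preimage_add,
    ← Measure.restrict_map (measurable_const_add a) hs, map_add_left_eq_self]

theorem cond_volume_Icc_real {c : ℝ} (hc : 0 < c) (a b : ℝ) :
    (cond (volume : Measure ℝ) (Set.Icc a (a + c))).real (Set.Icc b (b + c)) =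
      max 0 (1 - |b - a| / c) := by
  rw [measureReal_def, cond_apply measurableSet_Icc, Set.Icc_inter_Icc, ENNReal.toReal_mul,
    ENNReal.toReal_inv, ← measureReal_def, ← measureReal_def,
    Real.volume_real_Icc_of_le (le_add_of_nonneg_right hc.le), Real.volume_real_Icc,
    add_sub_cancel_left, max_comm, mul_max_of_nonneg _ _ (inv_nonneg.2 hc.le), mul_zero,
    min_add_add_right, add_sub_right_comm, ← neg_sub, max_sub_min_eq_abs]
  congr 1
  field_simp
  ring

theorem isProbabilityMeasure_cond_volume_Icc {c : ℝ} (hc : 0 < c) (a : ℝ) :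
    IsProbabilityMeasure (cond (volume : Measure ℝ) (Set.Icc a (a + c))) :=
  cond_isProbabilityMeasure_of_finite (by simp [hc]) (by simp)

end UniformLaws

section UniformSmoothing

variable {d : ℕ} {l r p : ℝ}

theorem lipLower_lipUpper (l r p : ℝ) : lipLower l r (lipUpper l r p) = p :=
  add_sub_cancel_right _ _

/-- The support of `uniformScheme l x`. -/
def noiseCube (l : ℝ) (x : Fin d → ℝ) : Set (Fin d → ℝ) :=
  Set.univ.pi fun i => Set.Icc (x i) (x i + 2 * l)

theorem measurableSet_noiseCube (l : ℝ) (x : Fin d → ℝ) : MeasurableSet (noiseCube l x) :=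
  .univ_pi fun _ => measurableSet_Icc

theorem uniformScheme_eq_pi (hl : 0 < l) (x : Fin d → ℝ) :
    uniformScheme l x = Measure.pi fun i => cond volume (Set.Icc (x i) (x i + 2 * l)) := by
  have hshift (i : Fin d) : (cond (volume : Measure ℝ) (Set.Icc 0 (2 * l))).map (x i + ·) =
      cond volume (Set.Icc (x i) (x i + 2 * l)) := by
    have hmap := map_add_left_cond volume (x i) (measurableSet_Icc (a := x i) (b := x i + 2 * l))
    rwa [Set.preimage_const_add_Icc, sub_self, add_sub_cancel_left] at hmap
  have hprob (i : Fin d) := isProbabilityMeasure_cond_volume_Icc (mul_pos two_pos hl) (x i)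
  simp only [← hshift] at hprob ⊢
  exact Measure.pi_map_pi (f := fun i e => x i + e) fun i => by fun_prop

theorem isProbabilityMeasure_uniformScheme (hl : 0 < l) (x : Fin d → ℝ) :
    IsProbabilityMeasure (uniformScheme l x) := by
  have (i : Fin d) := isProbabilityMeasure_cond_volume_Icc (mul_pos two_pos hl) (x i)
  rw [uniformScheme_eq_pi hl]
  infer_instance

theorem uniformScheme_add_left (l : ℝ) (t x : Fin d → ℝ) :
    uniformScheme l (t + x) = (uniformScheme l x).map (t + ·) := by
  rw [uniformScheme, uniformScheme, Measure.map_map (by fun_prop) (by fun_prop)]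
  simp only [Function.comp_def, add_assoc]

theorem restrict_uniformScheme_noiseCube_comm (hl : 0 < l) (x x' : Fin d → ℝ) :
    (uniformScheme l x).restrict (noiseCube l x') =
      (uniformScheme l x').restrict (noiseCube l x) := by
  have (x : Fin d → ℝ) (i : Fin d) :=
    isProbabilityMeasure_cond_volume_Icc (mul_pos two_pos hl) (x i)
  rw [uniformScheme_eq_pi hl, uniformScheme_eq_pi hl, noiseCube, noiseCube,
    Measure.restrict_pi_pi, Measure.restrict_pi_pi]
  congr 1
  funext i
  exact cond_restrict_comm measurableSet_Icc measurableSet_Icc (by simp)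

theorem uniformScheme_real_noiseCube (hl : 0 < l) (x x' : Fin d → ℝ) :
    (uniformScheme l x).real (noiseCube l x') = ∏ i, max 0 (1 - |x' i - x i| / (2 * l)) := by
  have (i : Fin d) := isProbabilityMeasure_cond_volume_Icc (mul_pos two_pos hl) (x i)
  simp only [← cond_volume_Icc_real (mul_pos two_pos hl), uniformScheme_eq_pi hl, noiseCube,
    measureReal_def, Measure.pi_pi, ENNReal.toReal_prod]

theorem uniformScheme_noiseCube_compl (hl : 0 < l) (x : Fin d → ℝ) :
    uniformScheme l x (noiseCube l x)ᶜ = 0 := by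
  have := isProbabilityMeasure_uniformScheme hl x
  rw [← measureReal_eq_zero_iff, probReal_compl_eq_one_sub (measurableSet_noiseCube l x),
    uniformScheme_real_noiseCube hl]
  simp

theorem uniformScheme_real_noiseCube_compl_le (hl : 0 < l) (x x' : Fin d → ℝ) :
    (uniformScheme l x).real (noiseCube l x')ᶜ ≤ ‖WithLp.toLp 1 (x' - x)‖ / (2 * l) := by
  have hprob (i : Fin d) := isProbabilityMeasure_cond_volume_Icc (mul_pos two_pos hl) (x i)
  have hcompl : (noiseCube l x')ᶜ =
      ⋃ i, Function.eval i ⁻¹' (Set.Icc (x' i) (x' i + 2 * l))ᶜ := by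
    simp only [noiseCube, Set.pi_def, Set.mem_univ, Set.iInter_true, Set.compl_iInter,
      Set.preimage_compl]
  calc (uniformScheme l x).real (noiseCube l x')ᶜ
      ≤ ∑ i, (uniformScheme l x).real (Function.eval i ⁻¹' (Set.Icc (x' i) (x' i + 2 * l))ᶜ) := by
        rw [hcompl]
        exact measureReal_iUnion_fintype_le _
    _ = ∑ i, (1 - max 0 (1 - |x' i - x i| / (2 * l))) := by
        refine Finset.sum_congr rfl fun i _ => ?_
        rw [uniformScheme_eq_pi hl, (measurePreserving_eval _ i).measureReal_preimage
          measurableSet_Icc.compl.nullMeasurableSet, probReal_compl_eq_one_sub measurableSet_Icc,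
          cond_volume_Icc_real (mul_pos two_pos hl)]
    _ ≤ ∑ i, |x' i - x i| / (2 * l) :=
        Finset.sum_le_sum fun i _ => sub_le_comm.1 (le_max_right _ _)
    _ = ‖WithLp.toLp 1 (x' - x)‖ / (2 * l) := by
        rw [PiLp.norm_eq_of_L1, Finset.sum_div]
        rfl

theorem isLeast_testRegion_uniformScheme (hl : 0 < l) (x x' : Fin d → ℝ)
    (hp : p ∈ Set.Icc (0 : ℝ) 1) :
    IsLeast {v | (p, v) ∈ testRegion (uniformScheme l x) (uniformScheme l x')}
      (max 0 (p - (uniformScheme l x).real (noiseCube l x')ᶜ)) :=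
  have := isProbabilityMeasure_uniformScheme hl x
  have := isProbabilityMeasure_uniformScheme hl x'
  isLeast_testRegion_of_restrict_eq (measurableSet_noiseCube l x) (measurableSet_noiseCube l x')
    (uniformScheme_noiseCube_compl hl x) (uniformScheme_noiseCube_compl hl x')
    (restrict_uniformScheme_noiseCube_comm hl x x') hp

theorem isLeast_certValues_uniform (hl : 0 < l) (hr : 0 ≤ r) (hd : 0 < d) (x : Fin d → ℝ)
    (hp : p ∈ Set.Icc (0 : ℝ) 1) :
    IsLeast (certValues (uniformScheme l) (lpBall 1 r) x p) (max 0 (lipLower l r p)) := by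
  have := isProbabilityMeasure_uniformScheme hl x
  have hmem := add_single_mem_lpBall (q := 1) (abs_of_nonneg hr).le x ⟨0, hd⟩
  refine ⟨mem_certValues.2 ⟨_, hmem, ?_⟩, ?_⟩
  · have hmass : (uniformScheme l x).real (noiseCube l (x + Pi.single ⟨0, hd⟩ r)) =
        max 0 (1 - r / (2 * l)) := by
      rw [uniformScheme_real_noiseCube hl, Finset.prod_eq_single ⟨0, hd⟩]
      · simp [abs_of_nonneg hr]
      · intro i _ hi
        simp [Pi.single_eq_of_ne hi]
      · simp
    have hclip : max 0 (lipLower l r p) = max 0 (p - (1 - max 0 (1 - r / (2 * l)))) := by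
      obtain hle | hle := le_total 0 (1 - r / (2 * l))
      · rw [max_eq_right hle, lipLower, sub_sub_cancel]
      · rw [max_eq_left hle, max_eq_left, max_eq_left] <;> linarith [hp.2, lipLower.eq_def l r p]
    rw [hclip, ← hmass, ← probReal_compl_eq_one_sub (measurableSet_noiseCube l _)]
    exact (isLeast_testRegion_uniformScheme hl x _ hp).1
  · rintro v ⟨x', hx', hv⟩
    have hτ := uniformScheme_real_noiseCube_compl_le hl x x'
    have hr' : ‖WithLp.toLp 1 (x' - x)‖ ≤ r := hx'
    refine le_trans ?_ ((isLeast_testRegion_uniformScheme hl x x' hp).2 hv)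
    rw [lipLower]
    gcongr
    exact hτ.trans (by gcongr)

theorem isGreatest_certValues_uniform (hl : 0 < l) (hr : 0 ≤ r) (hd : 0 < d) (x : Fin d → ℝ)
    (hp : p ∈ Set.Icc (0 : ℝ) 1) :
    IsGreatest (certValues (uniformScheme l) (lpBall 1 r) x p) (min 1 (lipUpper l r p)) := by
  have := isProbabilityMeasure_uniformScheme (d := d) hl
  refine isGreatest_certValues_of_isLeast ?_
  rw [← max_sub_sub_left, sub_self, lipUpper, ← sub_sub]
  exact isLeast_certValues_uniform hl hr hd x (Set.Icc.mem_iff_one_sub_mem.1 hp)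

theorem certLower_certUpper_uniform_of_lipUpper_le_one (hl : 0 < l) (hr : 0 ≤ r) (x y : Fin d → ℝ)
    (hp : p ∈ Set.Icc (0 : ℝ) 1) (h1 : lipUpper l r p ≤ 1) :
    certLower (uniformScheme l) (lpBall 1 r) x
      (certUpper (uniformScheme l) (invBall (lpBall 1 r)) y p) = p := by
  have := isProbabilityMeasure_uniformScheme (d := d) hl
  rw [invBall_lpBall]
  obtain rfl | hd := d.eq_zero_or_pos
  · exact certLower_certUpper_of_eq_singleton
      (certValues_eq_singleton_of_subsingleton (self_mem_lpBall hr y) hp)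
      (certValues_eq_singleton_of_subsingleton (self_mem_lpBall hr x) hp)
  · have h0 : 0 ≤ lipUpper l r p := add_nonneg hp.1 (by positivity)
    refine certLower_certUpper_of_isGreatest_of_isLeast
      (isGreatest_certValues_uniform hl hr hd y hp) ?_
    simpa only [min_eq_right h1, lipLower_lipUpper, max_eq_right hp.1] using
      isLeast_certValues_uniform hl hr hd x ⟨h0, h1⟩

theorem certLower_certUpper_uniform_of_lt_one {q : ℝ≥0∞} [Fact (1 ≤ q)] (hl : 0 < l) (hr : 0 ≤ r)
    (x y : Fin d → ℝ) (hp : p ∈ Set.Icc (0 : ℝ) 1)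
    (h1 : certUpper (uniformScheme l) (invBall (lpBall q r)) y p < 1) :
    certLower (uniformScheme l) (lpBall q r) x
      (certUpper (uniformScheme l) (invBall (lpBall q r)) y p) = p :=
  have := isProbabilityMeasure_uniformScheme (d := d) hl
  certLower_certUpper_of_translation (uniformScheme_add_left l) add_mem_lpBall_add_left x
    (invBall_lpBall q r ▸ self_mem_lpBall hr y) hp h1

end UniformSmoothing

section RandomGrid

open scoped Pointwise

theorem measure_inter_iUnion_vadd_le {G X : Type*} [AddGroup G] [Countable G] [AddAction G X]
    [MeasurableSpace X] {μ : Measure X} [MeasurableConstVAdd G X] [VAddInvariantMeasure G X μ]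
    {F : Set X} (hF : IsAddFundamentalDomain G F μ) (A : Set X) :
    μ (F ∩ ⋃ g : G, g +ᵥ A) ≤ μ A := by
  rw [Set.inter_iUnion, hF.measure_eq_tsum A]
  simpa only [Set.inter_comm] using measure_iUnion_le fun g : G => F ∩ (g +ᵥ A)

theorem exists_add_mul_mem_Ico_of_ceil_ne {T a b s : ℝ} (hT : 0 < T) (hab : a ≤ b)
    (hne : ⌈(a - s) / T⌉ ≠ ⌈(b - s) / T⌉) : ∃ k : ℤ, s + k * T ∈ Set.Ico a b := by
  have hlt : ⌈(a - s) / T⌉ < ⌈(b - s) / T⌉ := (Int.ceil_mono (by gcongr)).lt_of_ne hne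
  have ha := (div_le_iff₀ hT).1 (Int.le_ceil ((a - s) / T))
  have hb := (lt_div_iff₀ hT).1 (Int.lt_ceil.1 hlt)
  exact ⟨⌈(a - s) / T⌉, by linarith, by linarith⟩

/-- `⌈(a - s) / T⌉` is the index of the cell of `a` in the grid `s + Tℤ`. -/
theorem cond_volume_Icc_real_ceil_ne_le {T : ℝ} (hT : 0 < T) (a b : ℝ) :
    (cond (volume : Measure ℝ) (Set.Icc 0 T)).real {s | ⌈(a - s) / T⌉ ≠ ⌈(b - s) / T⌉} ≤
      |b - a| / T := by
  wlog hab : a ≤ b generalizing a b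
  · simpa only [ne_comm, abs_sub_comm] using this b a (le_of_not_ge hab)
  have hcover : {s | ⌈(a - s) / T⌉ ≠ ⌈(b - s) / T⌉} ⊆
      ⋃ g : AddSubgroup.zmultiples T, g +ᵥ Set.Ico a b := by
    intro s hs
    obtain ⟨k, hk⟩ := exists_add_mul_mem_Ico_of_ceil_ne hT hab hs
    refine Set.mem_iUnion.2 ⟨-⟨k • T, AddSubgroup.zsmul_mem_zmultiples T k⟩,
      Set.mem_vadd_set_iff_neg_vadd_mem.2 ?_⟩
    rw [neg_neg]
    change k • T + s ∈ Set.Ico a b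
    rw [zsmul_eq_mul, add_comm]
    exact hk
  have hvolume : volume.real (Set.Icc 0 T ∩ {s | ⌈(a - s) / T⌉ ≠ ⌈(b - s) / T⌉}) ≤ b - a := by
    refine ENNReal.toReal_le_of_le_ofReal (sub_nonneg.2 hab) ?_
    calc volume (Set.Icc 0 T ∩ {s | ⌈(a - s) / T⌉ ≠ ⌈(b - s) / T⌉})
        = volume (Set.Ioc 0 (0 + T) ∩ {s | ⌈(a - s) / T⌉ ≠ ⌈(b - s) / T⌉}) := by
          rw [zero_add]
          exact measure_congr (Ioc_ae_eq_Icc.symm.inter (.refl _ _))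
      _ ≤ volume (Set.Ico a b) := (measure_mono (Set.inter_subset_inter_right _ hcover)).trans
          (measure_inter_iUnion_vadd_le (isAddFundamentalDomain_Ioc hT 0 volume) _)
      _ = ENNReal.ofReal (b - a) := Real.volume_Ico
  rw [measureReal_def, cond_apply measurableSet_Icc, ENNReal.toReal_mul, ENNReal.toReal_inv,
    ← measureReal_def, ← measureReal_def, Real.volume_real_Icc_of_le hT.le, sub_zero,
    inv_mul_eq_div, abs_of_nonneg (sub_nonneg.2 hab)]
  gcongr

end RandomGrid

section Coupling

/-- If `f` and `g` agree off `D`, then the laws of `f` and `g` share the image of the measure off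
`D`. -/
theorem abs_sub_le_of_mem_testRegion_map {Ω X : Type*} [MeasurableSpace Ω] [MeasurableSpace X]
    {ν : Measure Ω} [IsProbabilityMeasure ν] {f g : Ω → X} (hf : Measurable f)
    (hg : Measurable g) {D : Set Ω} (hD : MeasurableSet D) (hfg : Set.EqOn f g Dᶜ) {z : ℝ × ℝ}
    (hz : z ∈ testRegion (ν.map f) (ν.map g)) : |z.2 - z.1| ≤ ν.real D := by
  have := Measure.isProbabilityMeasure_map (μ := ν) hf.aemeasurable
  have := Measure.isProbabilityMeasure_map (μ := ν) hg.aemeasurable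
  have hcommon : (ν.restrict Dᶜ).map f = (ν.restrict Dᶜ).map g :=
    Measure.map_congr ((ae_restrict_iff' hD.compl).2 (.of_forall hfg))
  have hle_f : (ν.restrict Dᶜ).map f ≤ ν.map f := Measure.map_mono Measure.restrict_le_self hf
  have hle_g : (ν.restrict Dᶜ).map f ≤ ν.map g :=
    hcommon ▸ Measure.map_mono Measure.restrict_le_self hg
  have hmass : 1 - ((ν.restrict Dᶜ).map f).real Set.univ = ν.real D := by
    rw [map_measureReal_apply hf .univ, Set.preimage_univ, measureReal_restrict_apply_univ,
      probReal_compl_eq_one_sub hD, sub_sub_cancel]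
  have hfg_le := fst_le_of_mem_testRegion_of_common_le hle_f hle_g hz
  have hgf_le := fst_le_of_mem_testRegion_of_common_le hle_g hle_f (testRegion_swap.2 hz)
  rw [hmass] at hfg_le hgf_le
  exact abs_sub_le_iff.2 ⟨sub_le_iff_le_add'.2 hgf_le, sub_le_iff_le_add'.2 hfg_le⟩

end Coupling

section SplittingNoise

variable {d : ℕ} {l r p v : ℝ}

theorem measurable_splitPoint (l : ℝ) (x : Fin d → ℝ) : Measurable (splitPoint l x) := by
  have hceil {f : (Fin d → ℝ) → ℝ} (hf : Measurable f) : Measurable fun s => (⌈f s⌉ : ℝ) :=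
    measurable_from_top.comp hf.ceil
  refine measurable_pi_lambda _ fun i => ?_
  have := hceil (f := fun s => (x i - s i) / (2 * l)) (by fun_prop)
  have := hceil (f := fun s => (x i - s i) / (2 * l) - 1) (by fun_prop)
  unfold splitPoint
  fun_prop

theorem measurableSet_ceil_ne (T a b : ℝ) :
    MeasurableSet {s : ℝ | ⌈(a - s) / T⌉ ≠ ⌈(b - s) / T⌉} :=
  (measurableSet_eq_fun (Measurable.ceil (by fun_prop)) (Measurable.ceil (by fun_prop))).compl

theorem splitPoint_eq_of_ceil_eq {x x' s : Fin d → ℝ}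
    (h : ∀ i, ⌈(x i - s i) / (2 * l)⌉ = ⌈(x' i - s i) / (2 * l)⌉) :
    splitPoint l x s = splitPoint l x' s := by
  funext i
  simp only [splitPoint, Int.ceil_sub_one, h]

theorem abs_sub_le_of_mem_testRegion_splitScheme (hl : 0 < l) {ν : Measure (Fin d → ℝ)}
    [IsProbabilityMeasure ν]
    (hν : ∀ i, pdf.IsUniform (fun s : Fin d → ℝ => s i) (Set.Icc 0 (2 * l)) ν volume)
    {x x' : Fin d → ℝ} {z : ℝ × ℝ}
    (hz : z ∈ testRegion (splitScheme l ν x) (splitScheme l ν x')) :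
    |z.2 - z.1| ≤ ‖WithLp.toLp 1 (x' - x)‖ / (2 * l) := by
  have hmeas (i : Fin d) := measurableSet_ceil_ne (2 * l) (x i) (x' i)
  set D : Set (Fin d → ℝ) := ⋃ i, (fun s => s i) ⁻¹'
    {s : ℝ | ⌈(x i - s) / (2 * l)⌉ ≠ ⌈(x' i - s) / (2 * l)⌉} with hD
  have heq : Set.EqOn (splitPoint l x) (splitPoint l x') Dᶜ := fun s hs =>
    splitPoint_eq_of_ceil_eq (by simpa [hD] using hs)
  calc |z.2 - z.1| ≤ ν.real D := abs_sub_le_of_mem_testRegion_map (measurable_splitPoint l x)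
        (measurable_splitPoint l x') (.iUnion fun i => measurable_pi_apply i (hmeas i)) heq hz
    _ ≤ ∑ i, ν.real ((fun s => s i) ⁻¹'
          {s : ℝ | ⌈(x i - s) / (2 * l)⌉ ≠ ⌈(x' i - s) / (2 * l)⌉}) :=
        measureReal_iUnion_fintype_le _
    _ ≤ ∑ i, |x' i - x i| / (2 * l) := Finset.sum_le_sum fun i _ => by
        rw [← map_measureReal_apply (measurable_pi_apply i) (hmeas i), hν i]
        exact cond_volume_Icc_real_ceil_ne_le (mul_pos two_pos hl) _ _
    _ = ‖WithLp.toLp 1 (x' - x)‖ / (2 * l) := by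
        rw [PiLp.norm_eq_of_L1, Finset.sum_div]
        rfl

theorem mem_Icc_of_mem_certValues_splitScheme (hl : 0 < l) {ν : Measure (Fin d → ℝ)}
    [IsProbabilityMeasure ν]
    (hν : ∀ i, pdf.IsUniform (fun s : Fin d → ℝ => s i) (Set.Icc 0 (2 * l)) ν volume)
    {x : Fin d → ℝ} (hv : v ∈ certValues (splitScheme l ν) (lpBall 1 r) x p) :
    v ∈ Set.Icc (lipLower l r p) (lipUpper l r p) := by
  obtain ⟨x', hx', hz⟩ := mem_certValues.1 hv
  have hr : ‖WithLp.toLp 1 (x' - x)‖ ≤ r := hx'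
  rw [lipLower, lipUpper, ← Real.closedBall_eq_Icc, Metric.mem_closedBall, Real.dist_eq]
  exact (abs_sub_le_of_mem_testRegion_splitScheme hl hν hz).trans (by gcongr)

end SplittingNoise

section LabelledEmbeddings

theorem exists_embedding_comp_eq {α β γ : Type*} [Fintype α] [Fintype β] [DecidableEq γ]
    {f : α → γ} {g : β → γ}
    (hfg : ∀ c, (Finset.univ.filter fun a => f a = c).card ≤
      (Finset.univ.filter fun b => g b = c).card) : ∃ φ : α ↪ β, g ∘ φ = f := by
  have hfiber (c : γ) : Nonempty ({a // f a = c} ↪ {b // g b = c}) :=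
    Function.Embedding.nonempty_of_card_le <| by simpa only [Fintype.card_subtype] using hfg c
  let e (c : γ) := (hfiber c).some
  exact ⟨(Equiv.sigmaFiberEquiv f).symm.toEmbedding.trans
    ((Function.Embedding.sigmaMap (.refl γ) e).trans (Equiv.sigmaFiberEquiv g).toEmbedding),
    funext fun a => (e (f a) ⟨a, rfl⟩).2⟩

/-- The number of bits of `x` that are equal to `c`. -/
def bitCount {ι : Type*} [Fintype ι] (x : ι → Bool) (c : Bool) : ℕ :=
  (Finset.univ.filter fun i => x i = c).card

theorem bitCount_not {ι : Type*} [Fintype ι] (x : ι → Bool) (c : Bool) :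
    bitCount (fun i => !x i) c = bitCount x (!c) := by
  simp only [bitCount, Bool.not_eq_eq_eq_not]

theorem bitCount_canonPoint (ra rd : ℕ) (c : Bool) :
    bitCount (canonPoint ra rd) c = if c then rd else ra := by
  rw [bitCount, Finset.card_filter, Fin.sum_univ_add]
  cases c <;> simp [canonPoint]

theorem bitCount_canonPoint' (ra rd : ℕ) : bitCount (canonPoint' ra rd) =
    bitCount (canonPoint rd ra) := by
  funext c
  refine (bitCount_not _ c).trans ?_
  cases c <;> simp [bitCount_canonPoint]

theorem HasBits.bitCount_canonPoint_le {d ra rd : ℕ} {x : Fin d → Bool} (hx : HasBits ra rd x)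
    (c : Bool) : bitCount (canonPoint ra rd) c ≤ bitCount x c := by
  rw [bitCount_canonPoint]
  cases c
  exacts [hx.1, hx.2]

theorem mem_sparseBall_iff {d ra rd : ℕ} {x x' : Fin d → Bool} :
    x' ∈ sparseBall ra rd x ↔
      ∀ c, (Finset.univ.filter fun i => x i = c ∧ x' i = !c).card ≤
        bitCount (canonPoint ra rd) c := by
  simp only [Bool.forall_bool, bitCount_canonPoint, sparseBall, Set.mem_ofPred_eq, Bool.not_false,
    Bool.not_true, Bool.false_eq_true, if_true, if_false, and_comm]

theorem bitCount_restrict_ne_le {d ra rd : ℕ} {x x' : Fin d → Bool}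
    (hx' : x' ∈ sparseBall ra rd x) (c : Bool) :
    bitCount (fun i : {i // x i ≠ x' i} => x i) c ≤ bitCount (canonPoint ra rd) c := by
  refine le_trans ?_ (mem_sparseBall_iff.1 hx' c)
  refine Finset.card_le_card_of_injOn Subtype.val (fun i hi => ?_) Subtype.val_injective.injOn
  have hic : x i = c := by simpa using hi
  simpa [hic, Bool.eq_not] using (hic ▸ i.2).symm

theorem HasBits.exists_mem_sparseBall {d ra rd : ℕ} {x : Fin d → Bool} (hx : HasBits ra rd x) :
    ∃ x' ∈ sparseBall ra rd x, ∃ φ : Fin (ra + rd) ↪ Fin d,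
      x ∘ φ = canonPoint ra rd ∧ x' ∘ φ = canonPoint' ra rd := by
  classical
  obtain ⟨φ, hφ⟩ := exists_embedding_comp_eq hx.bitCount_canonPoint_le
  refine ⟨fun i => if i ∈ Set.range φ then !x i else x i, mem_sparseBall_iff.2 fun c => ?_, φ, hφ,
    ?_⟩
  · refine (Finset.card_le_card fun i hi => ?_).trans_eq (Finset.card_map φ)
    obtain ⟨hic, hi'⟩ := (Finset.mem_filter.1 hi).2
    have hrange : i ∈ Set.range φ := by
      by_contra hi₀
      simp [hi₀, hic] at hi'
    obtain ⟨j, rfl⟩ := hrange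
    exact Finset.mem_map_of_mem φ (by simpa [← hφ] using hic)
  · funext j
    simp [canonPoint', ← hφ]

end LabelledEmbeddings

section FiniteTests

variable {X : Type*} [MeasurableSpace X] [DiscreteMeasurableSpace X]
  {μ ν : Measure X} [IsFiniteMeasure μ] [IsFiniteMeasure ν]

theorem testRegion_eq_image [Fintype X] : testRegion μ ν =
    (fun h : X → ℝ => (∑ x, h x * μ.real {x}, ∑ x, h x * ν.real {x})) ''
      Set.univ.pi fun _ => Set.Icc 0 1 := by
  have hint (ρ : Measure X) [IsFiniteMeasure ρ] (h : X → ℝ) :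
      ∫ x, h x ∂ρ = ∑ x, h x * ρ.real {x} := by
    simpa only [smul_eq_mul, mul_comm] using integral_fintype (μ := ρ) (f := h) .of_finite
  ext ⟨a, b⟩
  simp only [testRegion, hint, Measurable.of_discrete, true_and, Set.mem_ofPred_eq, Set.mem_image,
    Set.mem_univ_pi, Prod.mk.injEq]

theorem isCompact_testRegion [Finite X] : IsCompact (testRegion μ ν) := by
  have := Fintype.ofFinite X
  rw [testRegion_eq_image]
  exact (isCompact_univ_pi fun _ => isCompact_Icc).image (by fun_prop)

end FiniteTests

section ProductTests

variable {ι κ X : Type*} [Fintype ι] [Fintype κ] [MeasurableSpace X]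

theorem map_pi_comp_embedding (μ : ι → Measure X) [∀ i, IsProbabilityMeasure (μ i)] (φ : κ ↪ ι) :
    (Measure.pi μ).map (fun z => z ∘ φ) = Measure.pi fun j => μ (φ j) := by
  have hindep := (iIndepFun_pi (μ := μ) (X := fun _ t => t)
    fun i => aemeasurable_id).precomp φ.injective
  refine ((iIndepFun_iff_map_fun_eq_pi_map
    fun j => (measurable_pi_apply (φ j)).aemeasurable).1 hindep).trans ?_
  congr 1
  funext j
  exact (measurePreserving_eval μ (φ j)).map_eq

theorem testRegion_pi_comp_subset (μ ν : ι → Measure X) [∀ i, IsProbabilityMeasure (μ i)]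
    [∀ i, IsProbabilityMeasure (ν i)] (φ : κ ↪ ι) :
    testRegion (Measure.pi fun j => μ (φ j)) (Measure.pi fun j => ν (φ j)) ⊆
      testRegion (Measure.pi μ) (Measure.pi ν) := by
  rw [← map_pi_comp_embedding μ φ, ← map_pi_comp_embedding ν φ]
  exact testRegion_map_subset (by fun_prop)

/-- The coordinates on which two product measures agree can be simulated. -/
theorem testRegion_pi_subset_restrict (μ ν : ι → Measure X) [∀ i, IsProbabilityMeasure (μ i)]
    [∀ i, IsProbabilityMeasure (ν i)] (s : ι → Prop) [DecidablePred s]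
    (hs : ∀ i, ¬s i → μ i = ν i) :
    testRegion (Measure.pi μ) (Measure.pi ν) ⊆
      testRegion (Measure.pi fun i : Subtype s => μ i) (Measure.pi fun i : Subtype s => ν i) := by
  have hcompl : (Measure.pi fun i : {i // ¬s i} => μ i) =
      Measure.pi fun i : {i // ¬s i} => ν i := by
    congr 1
    exact funext fun i => hs i i.2
  rw [← testRegion_map_equiv (MeasurableEquiv.piEquivPiSubtypeProd (fun _ => X) s),
    (measurePreserving_piEquivPiSubtypeProd μ s).map_eq,
    (measurePreserving_piEquivPiSubtypeProd ν s).map_eq, hcompl]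
  exact testRegion_prod_subset _

end ProductTests

section NoisyBits

variable {ι κ : Type*} [Fintype ι] [Fintype κ] {p0 p1 : unitInterval}

/-- The law of a noisy version of the bit `b`, which is flipped with probability `p0` if `b = 0` and
`p1` if `b = 1`. -/
noncomputable def bitLaw (p0 p1 : unitInterval) (b : Bool) : Measure Bool :=
  bernoulliMeasure (!b) b (if b then p1 else p0)

/-- The law of a noisy version of a family of bits, which are flipped independently. -/
noncomputable def bitsLaw (p0 p1 : unitInterval) (x : ι → Bool) : Measure (ι → Bool) :=
  Measure.pi fun i => bitLaw p0 p1 (x i)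

instance isProbabilityMeasure_bitLaw (b : Bool) : IsProbabilityMeasure (bitLaw p0 p1 b) := by
  unfold bitLaw; infer_instance

instance isProbabilityMeasure_bitsLaw (x : ι → Bool) :
    IsProbabilityMeasure (bitsLaw p0 p1 x) := by
  unfold bitsLaw; infer_instance

theorem sparseScheme_eq_bitsLaw {d : ℕ} (x : Fin d → Bool) :
    sparseScheme p0 p1 x = bitsLaw p0 p1 x := by
  have hbit (b : Bool) : (bernoulliMeasure true false (if b then p1 else p0)).map (xor b) =
      bitLaw p0 p1 b := by
    rw [map_bernoulliMeasure, Bool.xor_true, Bool.xor_false, bitLaw]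
  have (i : Fin d) : SigmaFinite
      ((bernoulliMeasure true false (if x i then p1 else p0)).map (xor (x i))) := by
    rw [hbit]; infer_instance
  simp only [bitsLaw, ← hbit]
  exact Measure.pi_map_pi (f := fun i => xor (x i)) fun i => by fun_prop

theorem testRegion_bitsLaw_compl_subset {u : ι → Bool} {w : κ → Bool}
    (h : ∀ c, bitCount u c ≤ bitCount w c) :
    testRegion (bitsLaw p0 p1 u) (bitsLaw p0 p1 fun i => !u i) ⊆
      testRegion (bitsLaw p0 p1 w) (bitsLaw p0 p1 fun j => !w j) := by
  obtain ⟨φ, rfl⟩ := exists_embedding_comp_eq h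
  exact testRegion_pi_comp_subset (fun j => bitLaw p0 p1 (w j)) (fun j => bitLaw p0 p1 (!w j)) φ

theorem withDensity_bernoulliMeasure {X : Type*} [MeasurableSpace X] [MeasurableSingletonClass X]
    {x y : X} {p : unitInterval} {f : X → ℝ≥0} :
    (bernoulliMeasure x y p).withDensity (fun z => (f z : ℝ≥0∞)) =
      (unitInterval.toNNReal p * f x) • Measure.dirac x +
        (unitInterval.toNNReal (unitInterval.symm p) * f y) • Measure.dirac y := by
  rw [bernoulliMeasure_def, withDensity_add_measure]
  simp only [ENNReal.smul_def, withDensity_smul_measure, dirac_withDensity, smul_smul,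
    ENNReal.coe_mul]

/-- Flips of zero bits and flips of one bits change the likelihood ratio by the same factor `k`,
which is why it is a function of the Hamming distance. -/
theorem exists_bitLaw_not_eq_withDensity (h0 : p0 ∈ Set.Ioo 0 1) (h1 : p1 ∈ Set.Ioo 0 1) :
    ∃ (a : Bool → ℝ≥0) (k : ℝ≥0), ∀ b, bitLaw p0 p1 (!b) = (bitLaw p0 p1 b).withDensity
      fun c => ((a b * if b ≠ c then k else 1 : ℝ≥0) : ℝ≥0∞) := by
  have hpos (p : unitInterval) (hp : p ∈ Set.Ioo 0 1) : unitInterval.toNNReal p ≠ 0 ∧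
      unitInterval.toNNReal (unitInterval.symm p) ≠ 0 := by
    exact ⟨fun h => hp.1.ne' (Subtype.ext (congrArg NNReal.toReal h)),
      fun h => hp.2.ne (unitInterval.symm_eq_zero.1 (Subtype.ext (congrArg NNReal.toReal h)))⟩
  obtain ⟨hp0, hq0⟩ := hpos p0 h0
  obtain ⟨hp1, hq1⟩ := hpos p1 h1
  refine ⟨fun b => if b then unitInterval.toNNReal p0 / unitInterval.toNNReal (unitInterval.symm p1)
      else unitInterval.toNNReal p1 / unitInterval.toNNReal (unitInterval.symm p0),
    unitInterval.toNNReal (unitInterval.symm p0) * unitInterval.toNNReal (unitInterval.symm p1) /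
      (unitInterval.toNNReal p0 * unitInterval.toNNReal p1), fun b => ?_⟩
  rw [bitLaw, bitLaw, withDensity_bernoulliMeasure, bernoulliMeasure_def, add_comm]
  cases b
  · simp only [Bool.not_false, ↓reduceIte, Bool.not_true, Bool.false_eq_true, ne_eq,
      not_false_eq_true, not_true_eq_false, mul_one]
    congr 2 <;> field_simp
  · simp only [Bool.not_true, Bool.false_eq_true, ↓reduceIte, Bool.not_false, ne_eq,
      Bool.true_eq_false, not_false_eq_true, not_true_eq_false, mul_one]
    congr 2 <;> field_simp

theorem exists_bitsLaw_not_eq_withDensity (h0 : p0 ∈ Set.Ioo 0 1) (h1 : p1 ∈ Set.Ioo 0 1)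
    (u : ι → Bool) : ∃ c : ℕ → ℝ≥0, bitsLaw p0 p1 (fun i => !u i) =
      (bitsLaw p0 p1 u).withDensity fun z => (c (hammingDist u z) : ℝ≥0∞) := by
  obtain ⟨a, k, hak⟩ := exists_bitLaw_not_eq_withDensity h0 h1
  have hprod (z : ι → Bool) : ∏ i, (a (u i) * if u i ≠ z i then k else 1) =
      (∏ i, a (u i)) * k ^ hammingDist u z := by
    rw [Finset.prod_mul_distrib, Finset.prod_ite, Finset.prod_const, Finset.prod_const_one, mul_one,
      hammingDist]
  have (i : ι) : SigmaFinite ((bitLaw p0 p1 (u i)).withDensity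
      fun c => ((a (u i) * if u i ≠ c then k else 1 : ℝ≥0) : ℝ≥0∞)) := by
    rw [← hak]; infer_instance
  refine ⟨fun n => (∏ i, a (u i)) * k ^ n, ?_⟩
  simp only [bitsLaw, hak, ← hprod, ENNReal.ofNNReal_finsetProd]
  exact pi_withDensity _ fun i => .of_discrete

theorem bitsLaw_not_absolutelyContinuous (h0 : p0 ∈ Set.Ioo 0 1) (h1 : p1 ∈ Set.Ioo 0 1)
    (u : ι → Bool) : bitsLaw p0 p1 (fun i => !u i) ≪ bitsLaw p0 p1 u := by
  obtain ⟨c, hc⟩ := exists_bitsLaw_not_eq_withDensity h0 h1 u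
  exact hc ▸ withDensity_absolutelyContinuous _ _

end NoisyBits

section LinearProgram

variable {p0 p1 : unitInterval} {ra rd : ℕ} {p v : ℝ}

/-- The Hamming distance to `canonPoint`, as the index of a region of constant likelihood ratio. -/
def region (ra rd : ℕ) (z : Fin (ra + rd) → Bool) : Fin (ra + rd + 1) :=
  ⟨hammingDist (canonPoint ra rd) z, Nat.lt_succ_of_le
    (hammingDist_le_card_fintype.trans_eq (Fintype.card_fin _))⟩

theorem map_region_real_singleton (μ : Measure (Fin (ra + rd) → Bool)) (q : Fin (ra + rd + 1)) :
    (μ.map (region ra rd)).real {q} = μ.real {z | hammingDist (canonPoint ra rd) z = q} := by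
  rw [map_measureReal_apply .of_discrete (.singleton q)]
  simp only [region, Set.preimage, Set.mem_singleton_iff, Fin.ext_iff]

theorem mem_lpValues_iff_mem_testRegion_map : v ∈ lpValues p0 p1 ra rd p ↔
    (p, v) ∈ testRegion ((bitsLaw p0 p1 (canonPoint ra rd)).map (region ra rd))
      ((bitsLaw p0 p1 (canonPoint' ra rd)).map (region ra rd)) := by
  simp only [testRegion_eq_image, map_region_real_singleton, lpValues, regionMass, regionMass',
    sparseScheme_eq_bitsLaw, Set.mem_ofPred_eq, Set.mem_image, Set.mem_univ_pi, Prod.mk.injEq]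

/-- The Hamming distance to `canonPoint` is a sufficient statistic. -/
theorem mem_lpValues (h0 : p0 ∈ Set.Ioo 0 1) (h1 : p1 ∈ Set.Ioo 0 1) :
    v ∈ lpValues p0 p1 ra rd p ↔
      (p, v) ∈ testRegion (bitsLaw p0 p1 (canonPoint ra rd))
        (bitsLaw p0 p1 (canonPoint' ra rd)) := by
  obtain ⟨c, hc⟩ := exists_bitsLaw_not_eq_withDensity h0 h1 (canonPoint ra rd)
  change bitsLaw p0 p1 (canonPoint' ra rd) = _ at hc
  have : IsFiniteMeasure ((bitsLaw p0 p1 (canonPoint ra rd)).withDensity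
      fun z => (c (region ra rd z) : ℝ≥0∞)) := by
    change IsFiniteMeasure ((bitsLaw p0 p1 (canonPoint ra rd)).withDensity
      fun z => (c (hammingDist (canonPoint ra rd) z) : ℝ≥0∞))
    rw [← hc]
    infer_instance
  rw [mem_lpValues_iff_mem_testRegion_map, hc]
  exact Set.ext_iff.1 (testRegion_map_withDensity_comp (T := region ra rd) .of_discrete
    (c := fun q => c q) .of_discrete) (p, v)

theorem isCompact_lpValues (p0 p1 : unitInterval) (ra rd : ℕ) (p : ℝ) :
    IsCompact (lpValues p0 p1 ra rd p) := by
  have hsection : lpValues p0 p1 ra rd p = Prod.snd '' (testRegion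
      ((bitsLaw p0 p1 (canonPoint ra rd)).map (region ra rd))
      ((bitsLaw p0 p1 (canonPoint' ra rd)).map (region ra rd)) ∩ {z | z.1 = p}) := by
    ext v
    simp only [mem_lpValues_iff_mem_testRegion_map, Set.mem_image, Set.mem_inter_iff,
      Set.mem_ofPred_eq, Prod.exists, exists_eq_right]
  rw [hsection]
  exact (isCompact_testRegion.inter_right (isClosed_eq continuous_fst continuous_const)).image
    continuous_snd

theorem nonempty_lpValues (hp : p ∈ Set.Icc (0 : ℝ) 1) : (lpValues p0 p1 ra rd p).Nonempty := by
  have hμ (x : Fin (ra + rd) → Bool) := Measure.isProbabilityMeasure_map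
    (μ := bitsLaw p0 p1 x) (f := region ra rd) Measurable.of_discrete.aemeasurable
  have := hμ (canonPoint ra rd)
  have := hμ (canonPoint' ra rd)
  exact ⟨p, mem_lpValues_iff_mem_testRegion_map.2 (mk_self_mem_testRegion hp)⟩

theorem isLeast_sparseLower (hp : p ∈ Set.Icc (0 : ℝ) 1) :
    IsLeast (lpValues p0 p1 ra rd p) (sparseLower p0 p1 ra rd p) :=
  (isCompact_lpValues p0 p1 ra rd p).isLeast_sInf (nonempty_lpValues hp)

theorem isGreatest_sparseUpper (hp : p ∈ Set.Icc (0 : ℝ) 1) :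
    IsGreatest (lpValues p0 p1 ra rd p) (sparseUpper p0 p1 ra rd p) :=
  (isCompact_lpValues p0 p1 ra rd p).isGreatest_sSup (nonempty_lpValues hp)

theorem testRegion_bitsLaw_canonPoint_swap (p0 p1 : unitInterval) (ra rd : ℕ) :
    testRegion (bitsLaw p0 p1 (canonPoint rd ra)) (bitsLaw p0 p1 (canonPoint' rd ra)) =
      testRegion (bitsLaw p0 p1 (canonPoint' ra rd)) (bitsLaw p0 p1 (canonPoint ra rd)) := by
  have hnot : (fun i => !canonPoint' ra rd i) = canonPoint ra rd :=
    funext fun i => Bool.not_not (canonPoint ra rd i)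
  have hcount := bitCount_canonPoint' ra rd
  rw [← hnot]
  exact (testRegion_bitsLaw_compl_subset fun c => (congrFun hcount c).ge).antisymm
    (testRegion_bitsLaw_compl_subset fun c => (congrFun hcount c).le)

theorem mem_lpValues_swap (h0 : p0 ∈ Set.Ioo 0 1) (h1 : p1 ∈ Set.Ioo 0 1) :
    v ∈ lpValues p0 p1 rd ra p ↔ p ∈ lpValues p0 p1 ra rd v := by
  rw [mem_lpValues h0 h1, mem_lpValues h0 h1, testRegion_bitsLaw_canonPoint_swap, testRegion_swap]

theorem one_le_of_one_mem_lpValues (h0 : p0 ∈ Set.Ioo 0 1) (h1 : p1 ∈ Set.Ioo 0 1)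
    (h : 1 ∈ lpValues p0 p1 ra rd p) : 1 ≤ p := by
  have hac := bitsLaw_not_absolutelyContinuous h0 h1 (canonPoint rd ra)
  rw [← mem_lpValues_swap h0 h1, mem_lpValues h0 h1] at h
  exact (eq_one_of_one_mem_testRegion hac h).ge

theorem sparseLower_sparseUpper (h0 : p0 ∈ Set.Ioo 0 1) (h1 : p1 ∈ Set.Ioo 0 1) (ra rd : ℕ)
    (hp : p ∈ Set.Icc (0 : ℝ) 1) : sparseLower p0 p1 ra rd (sparseUpper p0 p1 rd ra p) = p := by
  set R := testRegion (bitsLaw p0 p1 (canonPoint rd ra)) (bitsLaw p0 p1 (canonPoint' rd ra))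
  have hlp {u v : ℝ} : v ∈ lpValues p0 p1 rd ra u ↔ (u, v) ∈ R := mem_lpValues h0 h1
  have hU := isGreatest_sparseUpper (p0 := p0) (p1 := p1) (ra := rd) (rd := ra) hp
  have hstar : StarConvex ℝ (1, 1) R :=
    convex_testRegion.starConvex (mk_self_mem_testRegion ⟨zero_le_one, le_rfl⟩)
  have hL : IsLeast {u | (u, sparseUpper p0 p1 rd ra p) ∈ R} p := by
    refine isLeast_of_isGreatest_of_starConvex hstar hp.2 ?_ ?_ fun u hu => ?_
    · simpa only [← hlp] using! hU
    · exact (testRegion_subset_Icc_prod_Icc (hlp.1 hU.1)).2.2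
    · exact one_le_of_one_mem_lpValues h0 h1 (hlp.2 hu)
  have hsection : lpValues p0 p1 ra rd (sparseUpper p0 p1 rd ra p) =
      {u | (u, sparseUpper p0 p1 rd ra p) ∈ R} :=
    Set.ext fun u => (mem_lpValues_swap h0 h1).trans hlp
  exact (congrArg sInf hsection).trans hL.csInf_eq

end LinearProgram

section SparseSmoothing

variable {d ra rd : ℕ} {p0 p1 : unitInterval} {x : Fin d → Bool} {p : ℝ}

theorem certValues_sparseScheme_subset_lpValues (h0 : p0 ∈ Set.Ioo 0 1) (h1 : p1 ∈ Set.Ioo 0 1) :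
    certValues (sparseScheme p0 p1) (sparseBall ra rd) x p ⊆ lpValues p0 p1 ra rd p := by
  intro v hv
  obtain ⟨x', hx', hxv⟩ := mem_certValues.1 hv
  rw [sparseScheme_eq_bitsLaw, sparseScheme_eq_bitsLaw] at hxv
  have hflip : (fun i : {i // x i ≠ x' i} => x' i) =
      fun i : {i // x i ≠ x' i} => !x i := funext fun i => (Bool.not_eq.2 i.2).symm
  have hrestrict := testRegion_pi_subset_restrict _ _ (fun i => x i ≠ x' i)
    (fun i hi => by rw [not_ne_iff.1 hi]) hxv
  refine (mem_lpValues h0 h1).2 (testRegion_bitsLaw_compl_subset (bitCount_restrict_ne_le hx') ?_)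
  rw [← hflip]
  exact hrestrict

theorem HasBits.certValues_sparseScheme_eq_lpValues (h0 : p0 ∈ Set.Ioo 0 1)
    (h1 : p1 ∈ Set.Ioo 0 1) (hx : HasBits ra rd x) :
    certValues (sparseScheme p0 p1) (sparseBall ra rd) x p = lpValues p0 p1 ra rd p := by
  refine (certValues_sparseScheme_subset_lpValues h0 h1).antisymm fun v hv => ?_
  obtain ⟨x', hx', φ, hφ, hφ'⟩ := hx.exists_mem_sparseBall
  refine mem_certValues.2 ⟨x', hx', ?_⟩
  rw [mem_lpValues h0 h1, ← hφ, ← hφ'] at hv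
  rw [sparseScheme_eq_bitsLaw, sparseScheme_eq_bitsLaw]
  exact testRegion_pi_comp_subset _ _ φ hv

theorem mem_Icc_of_mem_certValues_sparseScheme (h0 : p0 ∈ Set.Ioo 0 1) (h1 : p1 ∈ Set.Ioo 0 1)
    {v : ℝ} (hv : v ∈ certValues (sparseScheme p0 p1) (sparseBall ra rd) x p) :
    v ∈ Set.Icc (sparseLower p0 p1 ra rd p) (sparseUpper p0 p1 ra rd p) :=
  have hlp := isCompact_lpValues p0 p1 ra rd p
  have hv' := certValues_sparseScheme_subset_lpValues h0 h1 hv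
  ⟨csInf_le hlp.bddBelow hv', le_csSup hlp.bddAbove hv'⟩

theorem certLower_certUpper_sparse (h0 : p0 ∈ Set.Ioo 0 1) (h1 : p1 ∈ Set.Ioo 0 1)
    {y : Fin d → Bool} (hx : HasBits ra rd x) (hy : HasBits rd ra y) (hp : p ∈ Set.Icc (0 : ℝ) 1) :
    certLower (sparseScheme p0 p1) (sparseBall ra rd) x
      (certUpper (sparseScheme p0 p1) (invBall (sparseBall ra rd)) y p) = p := by
  rw [certLower, certUpper, invBall_sparseBall, hx.certValues_sparseScheme_eq_lpValues h0 h1,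
    hy.certValues_sparseScheme_eq_lpValues h0 h1]
  exact sparseLower_sparseUpper h0 h1 ra rd hp

end SparseSmoothing

end Smoothing

theorem mainTheorem4 :
    -- the inverted balls
    (∀ (d : ℕ) (r : ℝ),
      Smoothing.invBall (Smoothing.lpBall (d := d) 1 r) = Smoothing.lpBall 1 r ∧
      Smoothing.invBall (Smoothing.lpBall (d := d) 2 r) = Smoothing.lpBall 2 r) ∧
    (∀ d ra rd : ℕ,
      Smoothing.invBall (Smoothing.sparseBall (d := d) ra rd) = Smoothing.sparseBall rd ra) ∧
    -- Gaussian smoothing under the `ℓ₁` and the `ℓ₂` ball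
    (∀ (d : ℕ) (σ : ℝ≥0) (r : ℝ) (q : ℝ≥0∞), 0 < σ → 0 ≤ r → q = 1 ∨ q = 2 →
      (0 < d → ∀ (x : Fin d → ℝ) (p : ℝ), p ∈ Set.Ioo (0 : ℝ) 1 →
        IsLeast (Smoothing.certValues (Smoothing.gaussianScheme σ) (Smoothing.lpBall q r) x p)
          (Smoothing.gaussCDF σ (Smoothing.gaussQuantile σ p - r)) ∧
        IsGreatest (Smoothing.certValues (Smoothing.gaussianScheme σ) (Smoothing.lpBall q r) x p)
          (Smoothing.gaussCDF σ (Smoothing.gaussQuantile σ p + r))) ∧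
      (∀ (x y : Fin d → ℝ) (p : ℝ), p ∈ Set.Icc (0 : ℝ) 1 →
        Smoothing.certLower (Smoothing.gaussianScheme σ) (Smoothing.lpBall q r) x
          (Smoothing.certUpper (Smoothing.gaussianScheme σ)
            (Smoothing.invBall (Smoothing.lpBall q r)) y p) = p)) ∧
    -- uniform smoothing
    (∀ (d : ℕ) (l r : ℝ), 0 < l → 0 ≤ r →
      -- the Lipschitz bounds, for every `p`
      (∀ p : ℝ, Smoothing.lipLower l r (Smoothing.lipUpper l r p) = p) ∧
      -- up to clipping to `[0, 1]` they are the optimal bounds for additive noise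
      (0 < d → ∀ (x : Fin d → ℝ) (p : ℝ), p ∈ Set.Icc (0 : ℝ) 1 →
        IsLeast (Smoothing.certValues (Smoothing.uniformScheme l) (Smoothing.lpBall 1 r) x p)
          (max 0 (Smoothing.lipLower l r p)) ∧
        IsGreatest (Smoothing.certValues (Smoothing.uniformScheme l) (Smoothing.lpBall 1 r) x p)
          (min 1 (Smoothing.lipUpper l r p))) ∧
      -- the optimal bounds, as long as the upper bound is not clipped
      (∀ (x y : Fin d → ℝ) (p : ℝ), p ∈ Set.Icc (0 : ℝ) 1 → Smoothing.lipUpper l r p ≤ 1 →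
        Smoothing.certLower (Smoothing.uniformScheme l) (Smoothing.lpBall 1 r) x
          (Smoothing.certUpper (Smoothing.uniformScheme l)
            (Smoothing.invBall (Smoothing.lpBall 1 r)) y p) = p) ∧
      (∀ (x y : Fin d → ℝ) (p : ℝ), p ∈ Set.Icc (0 : ℝ) 1 →
        Smoothing.certUpper (Smoothing.uniformScheme l)
          (Smoothing.invBall (Smoothing.lpBall 2 r)) y p < 1 →
        Smoothing.certLower (Smoothing.uniformScheme l) (Smoothing.lpBall 2 r) x
          (Smoothing.certUpper (Smoothing.uniformScheme l)
            (Smoothing.invBall (Smoothing.lpBall 2 r)) y p) = p) ∧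
      -- the Lipschitz bounds are certified bounds for splitting noise
      (∀ ν : MeasureTheory.Measure (Fin d → ℝ), MeasureTheory.IsProbabilityMeasure ν →
        (∀ i, MeasureTheory.pdf.IsUniform (fun s : Fin d → ℝ => s i) (Set.Icc 0 (2 * l)) ν
          MeasureTheory.volume) →
        ∀ (x : Fin d → ℝ) (p : ℝ),
        ∀ v ∈ Smoothing.certValues (Smoothing.splitScheme l ν) (Smoothing.lpBall 1 r) x p,
          Smoothing.lipLower l r p ≤ v ∧ v ≤ Smoothing.lipUpper l r p)) ∧
    -- sparse smoothing
    (∀ (p0 p1 : unitInterval) (ra rd : ℕ), 0 < p0 → p0 < 1 → 0 < p1 → p1 < 1 →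
      (∀ p : ℝ, p ∈ Set.Icc (0 : ℝ) 1 →
        Smoothing.sparseLower p0 p1 ra rd (Smoothing.sparseUpper p0 p1 rd ra p) = p) ∧
      -- at every point the linear programs give valid bounds
      (∀ (d : ℕ) (x : Fin d → Bool) (p : ℝ),
        ∀ v ∈ Smoothing.certValues (Smoothing.sparseScheme p0 p1) (Smoothing.sparseBall ra rd) x p,
          Smoothing.sparseLower p0 p1 ra rd p ≤ v ∧ v ≤ Smoothing.sparseUpper p0 p1 ra rd p) ∧
      -- they are optimal at every point where the whole budget can be spent
      (∀ (d : ℕ) (x : Fin d → Bool) (p : ℝ), Smoothing.HasBits ra rd x →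
        p ∈ Set.Icc (0 : ℝ) 1 →
        IsLeast (Smoothing.certValues (Smoothing.sparseScheme p0 p1)
          (Smoothing.sparseBall ra rd) x p) (Smoothing.sparseLower p0 p1 ra rd p) ∧
        IsGreatest (Smoothing.certValues (Smoothing.sparseScheme p0 p1)
          (Smoothing.sparseBall ra rd) x p) (Smoothing.sparseUpper p0 p1 ra rd p)) ∧
      (∀ (d : ℕ) (x y : Fin d → Bool) (p : ℝ), Smoothing.HasBits ra rd x →
        Smoothing.HasBits rd ra y → p ∈ Set.Icc (0 : ℝ) 1 →
        Smoothing.certLower (Smoothing.sparseScheme p0 p1) (Smoothing.sparseBall ra rd) x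
          (Smoothing.certUpper (Smoothing.sparseScheme p0 p1)
            (Smoothing.invBall (Smoothing.sparseBall ra rd)) y p) = p)) := by
  refine ⟨fun d r => ⟨Smoothing.invBall_lpBall 1 r, Smoothing.invBall_lpBall 2 r⟩,
    fun d ra rd => Smoothing.invBall_sparseBall ra rd, fun d σ r q hσ hr hq => ?_,
    fun d l r hl hr => ?_, fun p0 p1 ra rd h0 h0' h1 h1' => ?_⟩
  · have : Fact (1 ≤ q) := ⟨by obtain rfl | rfl := hq <;> norm_num⟩
    have hq2 : q ≤ 2 := by obtain rfl | rfl := hq <;> norm_num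
    exact ⟨fun hd x p hp => ⟨Smoothing.isLeast_certValues_gaussian hσ.ne' hq2 hr hd x hp,
        Smoothing.isGreatest_certValues_gaussian hσ.ne' hq2 hr hd x hp⟩,
      fun x y p hp => Smoothing.certLower_certUpper_gaussian hσ.ne' hq2 hr x y hp⟩
  · exact ⟨Smoothing.lipLower_lipUpper l r,
      fun hd x p hp => ⟨Smoothing.isLeast_certValues_uniform hl hr hd x hp,
        Smoothing.isGreatest_certValues_uniform hl hr hd x hp⟩,
      fun x y p => Smoothing.certLower_certUpper_uniform_of_lipUpper_le_one hl hr x y,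
      fun x y p => Smoothing.certLower_certUpper_uniform_of_lt_one hl hr x y,
      fun ν _ hν x p v => Smoothing.mem_Icc_of_mem_certValues_splitScheme hl hν⟩
  · have hp0 : p0 ∈ Set.Ioo 0 1 := ⟨h0, h0'⟩
    have hp1 : p1 ∈ Set.Ioo 0 1 := ⟨h1, h1'⟩
    refine ⟨fun p => Smoothing.sparseLower_sparseUpper hp0 hp1 ra rd,
      fun d x p v => Smoothing.mem_Icc_of_mem_certValues_sparseScheme hp0 hp1,
      fun d x p hx hp => ?_, fun d x y p => Smoothing.certLower_certUpper_sparse hp0 hp1⟩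
    rw [hx.certValues_sparseScheme_eq_lpValues hp0 hp1]
    exact ⟨Smoothing.isLeast_sparseLower hp, Smoothing.isGreatest_sparseUpper hp⟩
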